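/- **Theorem.** Let $k\ge 3$ be an integer and let $\Gamma$ be one of $\Gamma_1(4)$, $\Gamma(4)$, $\Gamma_1(8)$. Put $K=\mathbb{Q}$ for $\Gamma=\Gamma_1(4)$ and for $\Gamma=\Gamma(4)$, and $K=\mathbb{Q}(\sqrt2)$ for $\Gamma=\Gamma_1(8)$. Let $\mathcal{E}_k(\Gamma)$ be the weight $k$ Eisenstein space, that is, the space of the modular forms of weight $k$ on $\Gamma$ that are complex linear combinations of the Eisenstein series $$\sum_{\substack{(c,d)\equiv a \ (\mathrm{mod}\ N)\\ \gcd(c,d)=1}}\frac{1}{(c\tau+d)^{k}},\qquad a\in(\mathbb{Z}/N\mathbb{Z})^2,$$ where $N=4$ for $\Gamma_1(4)$ and $\Gamma(4)$, and $N=8$ for $\Gamma_1(8)$. Let $\mathcal{E}_k^{(0,\infty)}(\Gamma;K)$ be the set of those $f\in\mathcal{E}_k(\Gamma)$ that vanish at the cusps $0$ and $\infty$ and whose $q$-coefficients lie in $K$ (the expansion being in powers of $e^{2\pi i\tau/4}$ for $\Gamma(4)$, and of $e^{2\pi i\tau}$ for $\Gamma_1(4)$ and $\Gamma_1(8)$).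 For such $f$ let $$L(f,s)=\frac{(2\pi)^s}{\Gamma(s)}\int_0^\infty f(ix)\,x^{s}\,\frac{dx}{x}.$$ Let $L_{D}(s)=\sum_{n\ge1}\left(\frac{D}{n}\right)n^{-s}$ for $D\in\{-4,8,-8\}$, where $\left(\frac{D}{\cdot}\right)$ is the Kronecker symbol. Then $$\operatorname{Span}_K\left\{(2\pi)^{k-1-s}L(f,s)\ \middle|\ s\in\{1,\dots,k-1\},\ f\in\mathcal{E}_k^{(0,\infty)}(\Gamma;K)\right\}$$ is contained in the $K$-span of the following numbers: $$\begin{cases} \{\pi^{k-1},\ \zeta(k-1)\} & k \text{ even and } \Gamma=\Gamma_1(4),\\ \varnothing \ (\text{so the span is } \{0\}) & k \text{ odd and } \Gamma=\Gamma_1(4),\\ \{\pi^{k-1},\ \zeta(k-1)\} & k \text{ even and } \Gamma=\Gamma(4),\\ \{\pi^{k-1},\ L_{-4}(k-1)\} & k \text{ odd and } \Gamma=\Gamma(4),\\ \{\pi^{k-1},\ \zeta(k-1),\ L_8(k-1)\} & k \text{ even and } \Gamma=\Gamma_1(8),\\ \{\pi^{k-1},\ L_{-4}(k-1),\ L_{-8}(k-1)\}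 & k \text{ odd and } \Gamma=\Gamma_1(8). \end{cases}$$ -/

import Mathlib

/-!
The `q`-coefficients of an Eisenstein series of weight `k` and level `N` are, up to a constant, the
twisted divisor sums `∑_{m d = n} φ(m, d) d ^ (k - 1)` with `φ(-m, -d) = (-1) ^ k φ(m, d)`. If they
lie in `K`, a `K`-linear projection `ℂ → K` makes `φ` itself `K`-valued. Hence `N ^ (-s) L(f, s)` is
a `K`-linear combination of products `L(A, s) L(B, s - k + 1)`, where `A` and `B` are `K`-valued
functions on `ℤ/N` whose parities add up to that of `k`. Consider such a product at an integer `s`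
with `1 ≤ s ≤ k - 1`, for a field `K` containing `2 cos (2 π / N)` and `2 sin (2 π / N)`.

* If `A` has the parity of `s`, then `L(A, s) ∈ K π ^ s` and `L(B, s - k + 1) ∈ K`.
* Otherwise `B` has a trivial zero at `s - k + 1`, except when `s = k - 1`, where
  `L(B, 0) = -B(0) / 2` leaves the value `L(A, k - 1)`. The zero kills the product unless `L(A, ·)`
  has a pole, which happens only at `s = 1`; there the derivative of `L(B, ·)` at `2 - k` is, by the
  functional equation, a multiple of `L(B̂, k - 1)` for the Fourier transform `B̂` of `B`.

So only `π ^ (k - 1)` and values at `k - 1` of `L`-functions of parity `(-1) ^ k` occur. For `N = 4`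
and `N = 8` these functions are combinations of dilates of the real Dirichlet characters.

For `N = 4`, `k` odd and `(1 1; 0 1) ∈ Γ`, the cusp `1/2` is irregular: up to sign `(2, 1)` and
`(2, 1) + (0, 2) = -(2, 1)` have the same value there. So an Eisenstein series vanishing at `0` and
`∞` vanishes at all cusps, hence is zero.
-/

open scoped MatrixGroups CongruenceSubgroup IntermediateField Real

noncomputable section

/-- A function on the upper half-plane lies in the weight `k` Eisenstein space of level `Γ(N)`: it is
a complex linear combination of the Eisenstein series
`∑ (c τ + d) ^ (-k)`, the sum over coprime `(c, d)` congruent to `a` modulo `N`, where `a` runs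
through all pairs of residues modulo `N`. (The series is zero if `a` is not of order `N`.) -/
def IsEisenstein (N : ℕ) (k : ℤ) (f : UpperHalfPlane → ℂ) : Prop :=
  f ∈ Submodule.span ℂ (Set.range fun a : Fin 2 → ZMod N => eisensteinSeries a k)

/-- All coefficients of the expansion of `f` in `q_h = exp (2 π i τ / h)` are in `K`, where `h` is the
width of the cusp `∞` of `Γ`, i.e. the least `h > 0` with `(1 h; 0 1) ∈ Γ`
(`1` for `Γ₁(N)`, and `N` for `Γ(N)`). -/
def HasCoeffsIn (K : IntermediateField ℚ ℂ) (Γ : Subgroup SL(2, ℤ)) (f : UpperHalfPlane → ℂ) : Prop :=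
  ∀ n : ℕ, (UpperHalfPlane.qExpansion
    (Γ : Subgroup (GL (Fin 2) ℝ)).strictWidthInfty f).coeff n ∈ K

/-- `ℰ_k^{(0,∞)}(Γ; K)` for a group `Γ` containing `Γ(N)`: the modular forms of weight `k` on `Γ` that
are in the Eisenstein space, vanish at the cusps `0` and `∞`, and have `q`-coefficients in `K`. -/
def eisensteinZeroInfty (K : IntermediateField ℚ ℂ) (Γ : Subgroup SL(2, ℤ)) (N : ℕ) (k : ℤ) :
    Set (ModularForm (Γ : Subgroup (GL (Fin 2) ℝ)) k) :=
  {f | IsEisenstein N k f ∧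
    OnePoint.IsZeroAt ((0 : ℝ) : OnePoint ℝ) f k ∧ OnePoint.IsZeroAt OnePoint.infty f k ∧
    HasCoeffsIn K Γ f}

/-- The `K`-span of the numbers `(2π)^(k-1-s) L(f,s)` with `s ∈ {1, …, k-1}` and
`f ∈ ℰ_k^{(0,∞)}(Γ; K)`. Here `L(f,s)` is Mathlib's (analytically continued) `ModularForm.L`; for `f`
vanishing at `0` and `∞` it is `(2π)^s / Γ(s) * ∫ x in (0,∞), f(ix) x^(s-1)`. -/
def eisensteinLSpan (K : IntermediateField ℚ ℂ) (Γ : Subgroup SL(2, ℤ)) [Γ.FiniteIndex]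
    (N k : ℕ) (hk : 0 < (k : ℤ)) : Submodule K ℂ :=
  Submodule.span K {z : ℂ | ∃ s : ℕ, 1 ≤ s ∧ s ≤ k - 1 ∧
    ∃ f ∈ eisensteinZeroInfty K Γ N k,
      z = (2 * (π : ℂ)) ^ (k - 1 - s) * ModularForm.L hk f (s : ℂ)}

/-- `L_{-4}(s) = ∑ (-4/n) n^{-s}`. -/
def LNegFour (s : ℂ) : ℂ := LSeries (fun n : ℕ => ((ZMod.χ₄ n : ℤ) : ℂ)) s

/-- `L_8(s) = ∑ (8/n) n^{-s}`. -/
def LEight (s : ℂ) : ℂ := LSeries (fun n : ℕ => ((ZMod.χ₈ n : ℤ) : ℂ)) s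

/-- `L_{-8}(s) = ∑ (-8/n) n^{-s}`. -/
def LNegEight (s : ℂ) : ℂ := LSeries (fun n : ℕ => ((ZMod.χ₈' n : ℤ) : ℂ)) s

/-- `ℚ(√2)` as a subfield of `ℂ`. -/
abbrev QSqrtTwo : IntermediateField ℚ ℂ := ℚ⟮((√2 : ℝ) : ℂ)⟯

/-- `ℚ` as a subfield of `ℂ`. -/
abbrev QField : IntermediateField ℚ ℂ := ⊥

end

noncomputable section

open UpperHalfPlane hiding I
open EisensteinSeries Complex ArithmeticFunction ZMod Filter Topology HurwitzZeta

/-- The lattice sum `∑ ψ(v mod N) (v₀ τ + v₁) ^ (-k)` over all `v` in `ℤ²`, without the coprimality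
condition of `eisensteinSeries`. -/
def latticeSeries {N : ℕ} (k : ℕ) (ψ : (Fin 2 → ZMod N) → ℂ) (τ : ℍ) : ℂ :=
  ∑' v : Fin 2 → ℤ, ψ (fun i => (v i : ZMod N)) * eisSummand k v τ

section LatticeSeries

variable {N k : ℕ}

lemma summable_mul_eisSummand [NeZero N] (hk : 3 ≤ k) (ψ : (Fin 2 → ZMod N) → ℂ) (τ : ℍ) :
    Summable fun v : Fin 2 → ℤ => ψ (fun i => (v i : ZMod N)) * eisSummand k v τ := by
  refine .of_norm_bounded
    ((summable_norm_eisSummand (k := k) (by exact_mod_cast hk) τ).mul_left ‖ψ‖) fun v => ?_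
  rw [norm_mul]
  gcongr
  exact norm_le_pi_norm ψ _

lemma latticeSeries_add [NeZero N] (hk : 3 ≤ k) (ψ₁ ψ₂ : (Fin 2 → ZMod N) → ℂ) :
    latticeSeries k (ψ₁ + ψ₂) = latticeSeries k ψ₁ + latticeSeries k ψ₂ := by
  ext τ
  simp only [latticeSeries, Pi.add_apply, add_mul]
  exact (summable_mul_eisSummand hk ψ₁ τ).tsum_add (summable_mul_eisSummand hk ψ₂ τ)

lemma latticeSeries_smul (c : ℂ) (ψ : (Fin 2 → ZMod N) → ℂ) :
    latticeSeries k (c • ψ) = c • latticeSeries k ψ := by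
  ext τ
  simp only [latticeSeries, Pi.smul_apply, smul_eq_mul, mul_assoc, tsum_mul_left]

lemma sum_divisors_moebius (n : ℕ) :
    ∑ d ∈ n.divisors, (moebius d : ℂ) = if n = 1 then 1 else 0 := by
  have h := congrArg (fun f : ArithmeticFunction ℂ => f n) (coe_moebius_mul_coe_zeta (R := ℂ))
  simpa only [coe_mul_zeta_apply, one_apply, intCoe_apply] using h

lemma tsum_moebius_of_dvd {v : Fin 2 → ℤ} (hv : v ≠ 0) :
    ∑' d : ℕ+, (if ∀ i, ((d : ℕ) : ℤ) ∣ v i then (moebius d : ℂ) else 0) =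
      if (v 0).gcd (v 1) = 1 then 1 else 0 := by
  set n := (v 0).gcd (v 1) with hn
  have hn0 : n ≠ 0 := by
    rw [hn, Ne, Int.gcd_eq_zero_iff]
    exact fun h => hv (funext (Fin.forall_fin_two.mpr h))
  have hdvd (d : ℕ) : (∀ i, (d : ℤ) ∣ v i) ↔ d ∈ n.divisors := by
    rw [Fin.forall_fin_two, ← Int.dvd_coe_gcd_iff, ← hn, Int.natCast_dvd_natCast,
      Nat.mem_divisors, and_iff_left hn0]
  have hsupp : (Function.support fun d : ℕ => if d ∈ n.divisors then (moebius d : ℂ) else 0) ⊆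
      Set.range ((↑) : ℕ+ → ℕ) := fun d hd =>
    ⟨⟨d, Nat.pos_of_mem_divisors (of_not_not fun h => hd (if_neg h))⟩, rfl⟩
  simp only [hdvd]
  rw [PNat.coe_injective.tsum_eq hsupp, tsum_eq_sum (s := n.divisors) fun d hd => if_neg hd,
    Finset.sum_ite_mem, Finset.inter_self, sum_divisors_moebius]

lemma tsum_ite_gcd_eq_one {F : (Fin 2 → ℤ) → ℂ} (h0 : F 0 = 0)
    (hF : Summable (Function.uncurry fun (d : ℕ+) v => (moebius d : ℂ) * F ((d : ℤ) • v))) :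
    ∑' v : Fin 2 → ℤ, (if (v 0).gcd (v 1) = 1 then F v else 0) =
      ∑' v : Fin 2 → ℤ, ∑' d : ℕ+, (moebius d : ℂ) * F ((d : ℤ) • v) := by
  let g : ℕ+ → (Fin 2 → ℤ) → ℂ := fun d v =>
    if ∀ i, ((d : ℕ) : ℤ) ∣ v i then (moebius d : ℂ) * F v else 0
  let dilate : ℕ+ × (Fin 2 → ℤ) → ℕ+ × (Fin 2 → ℤ) := fun p => (p.1, (p.1 : ℤ) • p.2)
  have dilate_injective : Function.Injective dilate := by
    rintro ⟨d, v⟩ ⟨d', v'⟩ h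
    obtain ⟨rfl, h⟩ := Prod.mk.inj h
    exact Prod.ext rfl (smul_right_injective _ (by positivity : ((d : ℕ) : ℤ) ≠ 0) h)
  have support_subset : Function.support (Function.uncurry g) ⊆ Set.range dilate := by
    rintro ⟨d, v⟩ h
    choose w hw using (of_not_not fun hd => h (if_neg hd) : ∀ i, ((d : ℕ) : ℤ) ∣ v i)
    exact ⟨(d, w), Prod.ext rfl (funext fun i => (hw i).symm)⟩
  have g_dilate : Function.uncurry g ∘ dilate =
      Function.uncurry fun (d : ℕ+) v => (moebius d : ℂ) * F ((d : ℤ) • v) := by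
    ext p
    simp [g, dilate, Function.uncurry]
  have hg : Summable (Function.uncurry g) :=
    (dilate_injective.summable_iff fun p hp =>
      of_not_not fun h => hp (support_subset h)).mp (g_dilate ▸ hF)
  calc ∑' v : Fin 2 → ℤ, (if (v 0).gcd (v 1) = 1 then F v else 0)
      = ∑' v, ∑' d : ℕ+, g d v := tsum_congr fun v => by
        rcases eq_or_ne v 0 with rfl | hv
        · simp [g, h0]
        · have hgv (d : ℕ+) :
              g d v = (if ∀ i, ((d : ℕ) : ℤ) ∣ v i then (moebius d : ℂ) else 0) * F v :=
            (ite_zero_mul _ _ _).symm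
          simp_rw [hgv]
          rw [tsum_mul_right, tsum_moebius_of_dvd hv, ite_zero_mul, one_mul]
    _ = ∑' p, Function.uncurry g (dilate p) := by
        rw [hg.tsum_comm, ← hg.tsum_prod_uncurry hg.prod_factor,
          dilate_injective.tsum_eq support_subset]
    _ = ∑' v : Fin 2 → ℤ, ∑' d : ℕ+, (moebius d : ℂ) * F ((d : ℤ) • v) := by
        rw [hF.tsum_comm, ← hF.tsum_prod_uncurry hF.prod_factor, ← g_dilate]
        rfl

lemma eisSummand_zero (hk : k ≠ 0) (τ : ℍ) : eisSummand k 0 τ = 0 := by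
  simp [eisSummand, hk]

lemma eisSummand_natCast_smul (d : ℕ) (v : Fin 2 → ℤ) (τ : ℍ) :
    eisSummand k ((d : ℤ) • v) τ = ((d : ℂ) ^ k)⁻¹ * eisSummand k v τ := by
  simp only [eisSummand, Pi.smul_apply, smul_eq_mul, Int.cast_mul, Int.cast_natCast, zpow_neg,
    zpow_natCast]
  rw [← mul_inv, ← mul_pow, mul_add, mul_assoc]

lemma summable_moebius_mul_eisSummand_smul (hk : 3 ≤ k) (a : Fin 2 → ZMod N) (τ : ℍ) :
    Summable (Function.uncurry fun (d : ℕ+) (v : Fin 2 → ℤ) => (moebius d : ℂ) *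
      ((if (fun i => ((((d : ℤ) • v) i : ℤ) : ZMod N)) = a then 1 else 0) *
        eisSummand k ((d : ℤ) • v) τ)) := by
  have hd : Summable fun d : ℕ+ => ‖((d : ℂ) ^ k)⁻¹‖ := by
    simpa using! ((Real.summable_nat_pow_inv (p := k)).mpr (by omega)).comp_injective
      PNat.coe_injective
  refine .of_norm_bounded (hd.mul_of_nonneg
    (summable_norm_eisSummand (k := k) (by exact_mod_cast hk) τ)
    (fun _ => norm_nonneg _) (fun _ => norm_nonneg _)) fun ⟨d, v⟩ => ?_
  have hμ : ‖(moebius d : ℂ)‖ ≤ 1 := by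
    rw [Complex.norm_intCast]
    exact_mod_cast abs_moebius_le_one
  have hite (p : Prop) [Decidable p] : ‖(if p then 1 else 0 : ℂ)‖ ≤ 1 := by
    split_ifs <;> simp
  rw [Function.uncurry_apply_pair, eisSummand_natCast_smul, norm_mul, norm_mul, norm_mul]
  exact (mul_le_of_le_one_left (by positivity) hμ).trans
    (mul_le_of_le_one_left (by positivity) (hite _))

lemma eisensteinSeries_eq_latticeSeries (hk : 3 ≤ k) (a : Fin 2 → ZMod N) :
    eisensteinSeries a k = latticeSeries k (fun b =>
      ∑' d : ℕ+, (moebius d : ℂ) * ((d : ℂ) ^ k)⁻¹ * (if (d : ZMod N) • b = a then 1 else 0)) := by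
  ext τ
  let F : (Fin 2 → ℤ) → ℂ := fun v =>
    (if (fun i => (v i : ZMod N)) = a then 1 else 0) * eisSummand k v τ
  calc eisensteinSeries a k τ
      = ∑' v : Fin 2 → ℤ, (if (v 0).gcd (v 1) = 1 then F v else 0) := by
        rw [eisensteinSeries, tsum_subtype (gammaSet N 1 a) (eisSummand k · τ)]
        refine tsum_congr fun v => ?_
        simp only [F, Set.indicator, gammaSet, Set.mem_ofPred_eq, Function.comp_def, ite_mul,
          one_mul, zero_mul, ← ite_and, and_comm]
    _ = ∑' v : Fin 2 → ℤ, ∑' d : ℕ+, (moebius d : ℂ) * F ((d : ℤ) • v) :=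
        tsum_ite_gcd_eq_one (by simp [F, eisSummand_zero (by omega : k ≠ 0)])
          (summable_moebius_mul_eisSummand_smul hk a τ)
    _ = _ := by
        refine tsum_congr fun v => ?_
        rw [← tsum_mul_right]
        refine tsum_congr fun d => ?_
        have hdv : (fun i => ((((d : ℤ) • v) i : ℤ) : ZMod N)) =
            (d : ZMod N) • fun i => (v i : ZMod N) := by
          ext i
          simp
        simp only [F, hdv, eisSummand_natCast_smul]
        ring

lemma IsEisenstein.exists_eq_latticeSeries [NeZero N] (hk : 3 ≤ k) {f : ℍ → ℂ}
    (hf : IsEisenstein N k f) : ∃ ψ : (Fin 2 → ZMod N) → ℂ, f = latticeSeries k ψ := by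
  induction hf using Submodule.span_induction with
  | mem f hf =>
    obtain ⟨a, rfl⟩ := hf
    exact ⟨_, eisensteinSeries_eq_latticeSeries hk a⟩
  | zero => exact ⟨0, by ext; simp [latticeSeries]⟩
  | add f g _ _ hf hg =>
    obtain ⟨ψ₁, rfl⟩ := hf
    obtain ⟨ψ₂, rfl⟩ := hg
    exact ⟨ψ₁ + ψ₂, (latticeSeries_add hk _ _).symm⟩
  | smul c f _ hf =>
    obtain ⟨ψ, rfl⟩ := hf
    exact ⟨c • ψ, (latticeSeries_smul _ _).symm⟩

end LatticeSeries

/-- The divisor sum `∑_{c m = n} φ(c, m) m ^ l`, generalising `σ_l(n)`. -/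
def twistedSigma {N : ℕ} (l : ℕ) (φ : ZMod N → ZMod N → ℂ) (n : ℕ) : ℂ :=
  ∑ p ∈ n.divisorsAntidiagonal, φ p.1 p.2 * (p.2 : ℂ) ^ l

/-- The coefficients of the `q`-expansion of `latticeSeries k ψ`: the discrete Fourier transform, in
the second variable, of the part of `ψ` of the same parity as `k`, normalised as in Lipschitz'
formula. -/
def latticeKernel {N : ℕ} [NeZero N] (k : ℕ) (ψ : (Fin 2 → ZMod N) → ℂ) (x y : ZMod N) : ℂ :=
  (-2 * π * I) ^ k / ((k - 1).factorial * N ^ k) *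
    𝓕 (fun j => ψ ![x, j] + (-1) ^ k * ψ ![-x, -j]) (-y)

section QExpansion

variable {N k : ℕ} [NeZero N]

lemma tsum_int_eq_sum_zmod {R : Type*} [AddCommGroup R] [UniformSpace R] [IsUniformAddGroup R]
    [CompleteSpace R] [T0Space R] {f : ℤ → R} (hf : Summable f) :
    ∑' d, f d = ∑ r : ZMod N, ∑' m : ℤ, f (r.val + N * m) := by
  obtain ⟨n, rfl⟩ := Nat.exists_eq_succ_of_ne_zero (NeZero.ne N)
  let e : ZMod (n + 1) × ℤ ≃ ℤ := (Equiv.prodComm _ _).trans (Int.divModEquiv (n + 1)).symm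
  have he (r : ZMod (n + 1)) (m : ℤ) : e (r, m) = r.val + (n + 1 : ℕ) * m :=
    (add_comm _ _).trans (congrArg _ (mul_comm _ _))
  have hfe : Summable (f ∘ e) := e.summable_iff.mpr hf
  rw [← e.tsum_eq f]
  refine (hfe.tsum_prod.trans (tsum_fintype _)).trans ?_
  simp only [Function.comp_apply, he]

lemma im_div_natCast_pos {z : ℂ} (hz : 0 < z.im) : 0 < (z / N).im := by
  rw [← Complex.ofReal_natCast N, Complex.div_ofReal_im]
  exact div_pos hz (Nat.cast_pos.mpr (NeZero.pos N))

lemma tsum_int_residue_zpow (hk : 2 ≤ k) (z : ℍ) (r : ℕ) :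
    ∑' m : ℤ, ((z : ℂ) + (r + N * m : ℤ)) ^ (-(k : ℤ)) =
      ∑' m : ℕ+, (-2 * π * I) ^ k / ((k - 1).factorial * N ^ k) * (stdAddChar (r * m : ZMod N) *
        ((m : ℂ) ^ (k - 1) * cexp (2 * π * I * z / N) ^ (m : ℕ))) := by
  have hN : (N : ℂ) ≠ 0 := NeZero.ne _
  let w : ℍ := ⟨((z : ℂ) + r) / N, im_div_natCast_pos (by simpa using z.im_pos)⟩
  have hw : (w : ℂ) = ((z : ℂ) + r) / N := rfl
  have hexp (m : ℕ) : cexp (2 * π * I * w) ^ m =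
      stdAddChar (r * m : ZMod N) * cexp (2 * π * I * z / N) ^ m := by
    have hchar := stdAddChar_coe (N := N) (r * m : ℕ)
    push_cast at hchar
    rw [hchar, ← Complex.exp_nat_mul, ← Complex.exp_nat_mul, ← Complex.exp_add, hw]
    congr 1
    field_simp
    ring
  have hlipschitz := qExpansion_identity_pnat (k := k - 1) (by omega) w
  rw [Nat.sub_add_cancel (by omega)] at hlipschitz
  calc ∑' m : ℤ, ((z : ℂ) + (r + N * m : ℤ)) ^ (-(k : ℤ))
      = ∑' m : ℤ, ((N : ℂ) ^ k)⁻¹ * (1 / ((w : ℂ) + m) ^ k) := tsum_congr fun m => by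
        have hwm : (z : ℂ) + (r + N * m : ℤ) = N * (w + m) := by
          rw [hw]
          push_cast
          field_simp
          ring
        rw [hwm, zpow_neg, zpow_natCast, mul_pow, mul_inv, one_div]
    _ = ∑' m : ℕ+, ((N : ℂ) ^ k)⁻¹ * ((-2 * π * I) ^ k / (k - 1).factorial *
          ((m : ℂ) ^ (k - 1) * cexp (2 * π * I * w) ^ (m : ℕ))) := by
        rw [tsum_mul_left, hlipschitz, ← tsum_mul_left, ← tsum_mul_left]
    _ = _ := tsum_congr fun m => by
        rw [hexp]
        field_simp

lemma summable_zmod_mul_zpow (hk : 2 ≤ k) (g : ZMod N → ℂ) (z : ℂ) :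
    Summable fun d : ℤ => g d * (z + d) ^ (-(k : ℤ)) := by
  have h := (linear_right_summable z 1 (k := k) (by exact_mod_cast hk)).norm
  refine .of_norm_bounded (h.mul_left ‖g‖) fun d => ?_
  rw [norm_mul, Int.cast_one, one_mul, zpow_neg]
  gcongr
  exact norm_le_pi_norm g _

lemma tsum_zmod_mul_zpow (hk : 2 ≤ k) (g : ZMod N → ℂ) (z : ℍ) :
    ∑' d : ℤ, g d * ((z : ℂ) + d) ^ (-(k : ℤ)) =
      ∑' m : ℕ+, (-2 * π * I) ^ k / ((k - 1).factorial * N ^ k) * 𝓕 g (-(m : ZMod N)) *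
        (m : ℂ) ^ (k - 1) * cexp (2 * π * I * z / N) ^ (m : ℕ) := by
  let C : ℂ := (-2 * π * I) ^ k / ((k - 1).factorial * N ^ k)
  let q : ℂ := cexp (2 * π * I * z / N)
  have hq : ‖q‖ < 1 := by
    simpa [q, mul_div_assoc] using
      norm_exp_two_pi_I_lt_one ⟨(z : ℂ) / N, im_div_natCast_pos z.im_pos⟩
  have hsummable (r : ZMod N) : Summable fun m : ℕ+ => g r * (C * (stdAddChar (r.val * m : ZMod N) *
      ((m : ℂ) ^ (k - 1) * q ^ (m : ℕ)))) := by
    have hgeom : Summable fun m : ℕ+ => (m : ℂ) ^ (k - 1) * q ^ (m : ℕ) :=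
      (summable_pow_mul_geometric_of_norm_lt_one (k - 1) hq).comp_injective PNat.coe_injective
    refine (Summable.of_norm_bounded hgeom.norm fun m => ?_).mul_left C |>.mul_left (g r)
    rw [norm_mul, AddChar.norm_apply, one_mul]
  calc ∑' d : ℤ, g d * ((z : ℂ) + d) ^ (-(k : ℤ))
      = ∑ r : ZMod N, ∑' m : ℕ+, g r * (C * (stdAddChar (r.val * m : ZMod N) *
          ((m : ℂ) ^ (k - 1) * q ^ (m : ℕ)))) := by
        rw [tsum_int_eq_sum_zmod (N := N) (summable_zmod_mul_zpow hk g z)]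
        refine Finset.sum_congr rfl fun r _ => ?_
        rw [tsum_mul_left, ← tsum_int_residue_zpow hk z r.val, ← tsum_mul_left]
        simp
    _ = _ := by
        rw [← Summable.tsum_finsetSum fun r _ => hsummable r]
        refine tsum_congr fun m => ?_
        rw [dft_apply, Finset.mul_sum, Finset.sum_mul, Finset.sum_mul]
        refine Finset.sum_congr rfl fun r _ => ?_
        rw [natCast_zmod_val, mul_neg, neg_neg, smul_eq_mul]
        ring

lemma latticeKernel_neg (ψ : (Fin 2 → ZMod N) → ℂ) (x y : ZMod N) :
    latticeKernel k ψ (-x) (-y) = (-1) ^ k * latticeKernel k ψ x y := by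
  let Ψ : ZMod N → ℂ := fun j => ψ ![x, j] + (-1) ^ k * ψ ![-x, -j]
  have hΨ : (fun j => ψ ![-x, j] + (-1) ^ k * ψ ![- -x, -j]) = fun j => (-1) ^ k * Ψ (-j) := by
    ext j
    simp only [Ψ, neg_neg, mul_add, ← mul_assoc, ← mul_pow]
    norm_num [add_comm]
  rw [latticeKernel, hΨ, dft_const_mul, dft_comp_neg, neg_neg, mul_left_comm, latticeKernel]

/-- Pairing the rows `c` and `-c` of the lattice replaces `ψ` by its part of the parity of `k`. -/
lemma tsum_row_add_tsum_neg_row (hk : 2 ≤ k) (ψ : (Fin 2 → ZMod N) → ℂ) (τ : ℍ) (c : ℕ+) :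
    ∑' d : ℤ, ψ ![(c : ℤ), d] * ((c : ℤ) * τ + d : ℂ) ^ (-(k : ℤ)) +
        ∑' d : ℤ, ψ ![(-c : ℤ), d] * ((-c : ℤ) * τ + d : ℂ) ^ (-(k : ℤ)) =
      ∑' m : ℕ+, latticeKernel k ψ c m * (m : ℂ) ^ (k - 1) *
        cexp (2 * π * I * τ / N) ^ (c * m : ℕ) := by
  have hz : 0 < ((c : ℂ) * τ).im := by simpa using τ.im_pos
  have hpow (m : ℕ+) : cexp (2 * π * I * τ / N) ^ (c * m : ℕ) =
      cexp (2 * π * I * (c * (τ : ℂ)) / N) ^ (m : ℕ) := by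
    rw [pow_mul, ← Complex.exp_nat_mul]
    congr 2
    ring
  have hsign (d : ℤ) : ψ ![((-c : ℤ) : ZMod N), (-d : ℤ)] *
        ((-c : ℤ) * τ + (-d : ℤ) : ℂ) ^ (-(k : ℤ)) =
      (-1) ^ k * ψ ![-(c : ZMod N), -(d : ZMod N)] * ((c : ℂ) * τ + d) ^ (-(k : ℤ)) := by
    rw [show ((-c : ℤ) * τ + (-d : ℤ) : ℂ) = -1 * ((c : ℂ) * τ + d) by push_cast; ring, mul_zpow,
      zpow_neg (-1 : ℂ), zpow_natCast, ← inv_pow,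
      show (-1 : ℂ)⁻¹ = -1 by norm_num]
    push_cast
    ring
  simp_rw [hpow]
  rw [← (Equiv.neg ℤ).tsum_eq fun d => ψ ![((-c : ℤ) : ZMod N), d] * _, ← Summable.tsum_add]
  · refine Eq.trans (tsum_congr fun d => ?_) (tsum_zmod_mul_zpow hk
      (fun j => ψ ![(c : ZMod N), j] + (-1) ^ k * ψ ![-(c : ZMod N), -j]) ⟨(c : ℂ) * τ, hz⟩)
    rw [Equiv.neg_apply, hsign]
    push_cast
    exact (add_mul _ _ _).symm
  · exact summable_zmod_mul_zpow hk (fun j => ψ ![_, j]) _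
  · exact (Equiv.neg ℤ).summable_iff.mpr (summable_zmod_mul_zpow hk (fun j => ψ ![_, j]) _)

lemma norm_cexp_div_lt_one (τ : ℍ) : ‖cexp (2 * π * I * τ / N)‖ < 1 := by
  simpa [mul_div_assoc] using
    norm_exp_two_pi_I_lt_one ⟨(τ : ℂ) / N, im_div_natCast_pos τ.im_pos⟩

lemma summable_prod_zmod_mul_pow (φ : ZMod N → ZMod N → ℂ) (l : ℕ) {q : ℂ} (hq : ‖q‖ < 1) :
    Summable fun p : ℕ+ × ℕ+ => φ p.1 p.2 * (p.2 : ℂ) ^ l * q ^ (p.1 * p.2 : ℕ) := by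
  refine .of_norm_bounded ((summable_prod_mul_pow l hq).norm.mul_left ‖φ‖) fun p => ?_
  rw [mul_assoc, norm_mul]
  gcongr
  exact (norm_le_pi_norm (φ _) _).trans (norm_le_pi_norm φ _)

lemma hasSum_twistedSigma_mul_pow (φ : ZMod N → ZMod N → ℂ) (l : ℕ) {q : ℂ} (hq : ‖q‖ < 1) :
    HasSum (fun n => twistedSigma l φ n * q ^ n)
      (∑' p : ℕ+ × ℕ+, φ p.1 p.2 * (p.2 : ℂ) ^ l * q ^ (p.1 * p.2 : ℕ)) := by
  have hsigma := (sigmaAntidiagonalEquivProd.hasSum_iff.mpr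
    (summable_prod_zmod_mul_pow φ l hq).hasSum).sigma fun n => hasSum_fintype _
  have hpnat : HasSum (fun n : ℕ+ => twistedSigma l φ n * q ^ (n : ℕ))
      (∑' p : ℕ+ × ℕ+, φ p.1 p.2 * (p.2 : ℂ) ^ l * q ^ (p.1 * p.2 : ℕ)) := by
    refine hsigma.congr_fun fun n => ?_
    rw [twistedSigma, Finset.sum_mul, ← Finset.sum_attach]
    refine Finset.sum_congr rfl fun p _ => ?_
    simp [sigmaAntidiagonalEquivProd, divisorsAntidiagonalFactors,
      (Nat.mem_divisorsAntidiagonal.mp p.2).1]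
  simpa [twistedSigma] using
    (hasSum_pnat_iff (f := fun n : ℕ => twistedSigma l φ n * q ^ n)).mp hpnat

lemma hasSum_latticeSeries (hk : 3 ≤ k) (ψ : (Fin 2 → ZMod N) → ℂ) (τ : ℍ) :
    HasSum (fun n : ℕ => twistedSigma (k - 1) (latticeKernel k ψ) n *
        cexp (2 * π * I * τ / N) ^ n)
      (latticeSeries k ψ τ - ∑' d : ℤ, ψ ![0, d] * (d : ℂ) ^ (-(k : ℤ))) := by
  let F : ℤ × ℤ → ℂ := fun p => ψ ![p.1, p.2] * (p.1 * τ + p.2 : ℂ) ^ (-(k : ℤ))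
  have hψF : (fun v : Fin 2 → ℤ => ψ (fun i => (v i : ZMod N)) * eisSummand k v τ) ∘
      (finTwoArrowEquiv ℤ).symm = F := by
    ext p
    simp only [Function.comp_apply, F, eisSummand, finTwoArrowEquiv_symm_apply]
    congr 2
    ext i
    fin_cases i <;> rfl
  have hF : Summable F :=
    hψF ▸ (finTwoArrowEquiv ℤ).symm.summable_iff.mpr (summable_mul_eisSummand hk ψ τ)
  have hrows : Summable fun c : ℤ => ∑' d : ℤ, F (c, d) := hF.prod
  have hpos : Summable fun c : ℕ+ => ∑' d : ℤ, F ((c : ℕ), d) :=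
    hrows.comp_injective (i := fun c : ℕ+ => ((c : ℕ) : ℤ)) fun a b h => by simpa using h
  have hneg : Summable fun c : ℕ+ => ∑' d : ℤ, F (-(c : ℕ), d) :=
    hrows.comp_injective (i := fun c : ℕ+ => (-(c : ℕ) : ℤ)) fun a b h => by simpa using h
  have hq : ‖cexp (2 * π * I * τ / N)‖ < 1 := norm_cexp_div_lt_one τ
  convert hasSum_twistedSigma_mul_pow (latticeKernel k ψ) (k - 1) hq using 1
  rw [sub_eq_iff_eq_add', (summable_prod_zmod_mul_pow _ _ hq).tsum_prod]
  calc latticeSeries k ψ τ = ∑' c : ℤ, ∑' d : ℤ, F (c, d) := by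
        rw [← hF.tsum_prod, ← hψF]
        exact ((finTwoArrowEquiv ℤ).symm.tsum_eq _).symm
    _ = ∑' d : ℤ, F (0, d) +
          ∑' c : ℕ+, (∑' d : ℤ, F ((c : ℕ), d) + ∑' d : ℤ, F (-(c : ℕ), d)) := by
        rw [tsum_int_eq_zero_add_tsum_pnat hrows, add_assoc, hpos.tsum_add hneg]
    _ = _ := by
        refine congrArg₂ _ (by simp [F]) (tsum_congr fun c => ?_)
        exact tsum_row_add_tsum_neg_row (by omega) ψ τ c

lemma IsEisenstein.exists_hasSum (hk : 3 ≤ k) {f : ℍ → ℂ} (hf : IsEisenstein N k f) :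
    ∃ (φ : ZMod N → ZMod N → ℂ) (a₀ : ℂ), (∀ x y, φ (-x) (-y) = (-1) ^ k * φ x y) ∧
      ∀ τ : ℍ, HasSum (fun n : ℕ => twistedSigma (k - 1) φ n * cexp (2 * π * I * τ / N) ^ n)
        (f τ - a₀) := by
  obtain ⟨ψ, rfl⟩ := hf.exists_eq_latticeSeries hk
  exact ⟨_, _, latticeKernel_neg ψ, hasSum_latticeSeries hk ψ⟩

end QExpansion

section CoefficientField

variable {K : IntermediateField ℚ ℂ} {N k l : ℕ}

/-- A `K`-linear projection `ℂ → K`, applied to the values of `φ`, fixes divisor sums in `K`. -/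
lemma exists_mem_twistedSigma_eq {φ : ZMod N → ZMod N → ℂ}
    (hφ : ∀ x y, φ (-x) (-y) = (-1) ^ k * φ x y) (hmem : ∀ n, twistedSigma l φ n ∈ K) :
    ∃ φ' : ZMod N → ZMod N → ℂ, (∀ x y, φ' x y ∈ K) ∧
      (∀ x y, φ' (-x) (-y) = (-1) ^ k * φ' x y) ∧ twistedSigma l φ' = twistedSigma l φ := by
  obtain ⟨p, hp⟩ := (Algebra.linearMap K ℂ).exists_leftInverse_of_injective
    (LinearMap.ker_eq_bot.mpr (algebraMap K ℂ).injective)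
  refine ⟨fun x y => p (φ x y), fun x y => (p (φ x y)).2, fun x y => ?_, funext fun n => ?_⟩
  · rcases neg_one_pow_eq_or ℂ k with h | h <;> simp [hφ, h]
  · have hpn : (p (twistedSigma l φ n) : ℂ) = twistedSigma l φ n :=
      congrArg Subtype.val (LinearMap.congr_fun hp ⟨_, hmem n⟩)
    rw [← hpn, twistedSigma, twistedSigma, map_sum, AddSubmonoidClass.coe_finsetSum]
    refine Finset.sum_congr rfl fun q _ => ?_
    rw [mul_comm, mul_comm (φ _ _), ← Nat.cast_pow, ← nsmul_eq_mul, ← nsmul_eq_mul, map_nsmul]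
    rfl

end CoefficientField

section Width

/-- The coefficients of a power series in `q ^ t`, given those of the power series in `q`. -/
def spreadCoeff (t : ℕ) (a : ℕ → ℂ) (n : ℕ) : ℂ := if t ∣ n then a (n / t) else 0

lemma hasSum_spreadCoeff_mul_iff {t : ℕ} (ht : t ≠ 0) {a u : ℕ → ℂ} {S : ℂ} :
    HasSum (fun n => spreadCoeff t a n * u n) S ↔ HasSum (fun n => a n * u (t * n)) S := by
  have hinj : Function.Injective (t * · : ℕ → ℕ) := fun x y h =>
    Nat.eq_of_mul_eq_mul_left (Nat.pos_of_ne_zero ht) h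
  rw [← hinj.hasSum_iff]
  · refine iff_of_eq (congrArg (HasSum · S) (funext fun n => ?_))
    simp [spreadCoeff, Nat.pos_of_ne_zero ht]
  · intro n hn
    have hdvd : ¬ t ∣ n := fun ⟨c, hc⟩ => hn ⟨c, hc.symm⟩
    simp [spreadCoeff, hdvd]

variable {Γ : Subgroup (GL (Fin 2) ℝ)} {k : ℤ}

lemma qExpansion_natCast_mul_coeff [Fact (IsCusp OnePoint.infty Γ)] (f : ModularForm Γ k) {h : ℝ}
    (hh : 0 < h) (hΓ : h ∈ Γ.strictPeriods) {t : ℕ} (ht : t ≠ 0) (n : ℕ) :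
    (qExpansion (t * h) f).coeff n = spreadCoeff t (fun m => (qExpansion h f).coeff m) n := by
  have htΓ : t * h ∈ Γ.strictPeriods := nsmul_eq_mul t h ▸ nsmul_mem hΓ t
  refine (ModularFormClass.qExpansion_coeff_unique (f := f) (by positivity) htΓ
    (fun τ => ?_) n).symm
  simp only [smul_eq_mul]
  rw [hasSum_spreadCoeff_mul_iff ht]
  refine (ModularForm.hasSum_qExpansion f hh hΓ τ).congr_fun fun m => ?_
  have htc : (t : ℂ) ≠ 0 := Nat.cast_ne_zero.mpr ht
  have hhc : (h : ℂ) ≠ 0 := ofReal_ne_zero.mpr hh.ne'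
  rw [pow_mul, Function.Periodic.qParam, Function.Periodic.qParam, ← Complex.exp_nat_mul]
  congr 3
  push_cast
  field_simp

variable {N : ℕ} [NeZero N]

lemma qExpansion_coeff_eq_twistedSigma {k : ℕ} (hk : 3 ≤ k) (hN : (N : ℝ) ∈ Γ.strictPeriods)
    {f : ModularForm Γ k} (hf : IsEisenstein N k f) :
    ∃ φ : ZMod N → ZMod N → ℂ, (∀ x y, φ (-x) (-y) = (-1) ^ k * φ x y) ∧
      ∀ n ≠ 0, (qExpansion N f).coeff n = twistedSigma (k - 1) φ n := by
  obtain ⟨φ, a₀, hφ, hsum⟩ := hf.exists_hasSum hk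
  refine ⟨φ, hφ, fun n hn => ?_⟩
  have hexp (τ : ℍ) : HasSum (fun m => (twistedSigma (k - 1) φ m + if m = 0 then a₀ else 0) •
      Function.Periodic.qParam N τ ^ m) (f τ) := by
    rw [← sub_add_cancel (f τ) a₀]
    refine ((hsum τ).add (hasSum_ite_eq 0 a₀)).congr_fun fun m => ?_
    rcases eq_or_ne m 0 with rfl | hm
    · simp [twistedSigma]
    · simp [hm, Function.Periodic.qParam]
  rw [← ModularFormClass.qExpansion_coeff_unique (Nat.cast_pos.mpr (NeZero.pos N)) hN hexp n]
  simp [hn]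

variable [Γ.IsArithmetic]

lemma exists_natCast_eq_mul_strictWidthInfty (hN : (N : ℝ) ∈ Γ.strictPeriods) :
    ∃ t : ℕ, t ≠ 0 ∧ (N : ℝ) = t * Γ.strictWidthInfty := by
  rw [Subgroup.strictPeriods_eq_zmultiples_strictWidthInfty] at hN
  obtain ⟨z, hz⟩ := AddSubgroup.mem_zmultiples_iff.mp hN
  rw [zsmul_eq_mul] at hz
  have hNpos : (0 : ℝ) < N := Nat.cast_pos.mpr (NeZero.pos N)
  have hzpos : 0 < z :=
    Int.cast_pos.mp (pos_of_mul_pos_left (hz ▸ hNpos) Γ.strictWidthInfty_nonneg)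
  refine ⟨z.toNat, by omega, ?_⟩
  rw [← hz, ← Int.cast_natCast z.toNat, Int.toNat_of_nonneg hzpos.le]

lemma qExpansion_natCast_coeff_mem {K : IntermediateField ℚ ℂ} (hN : (N : ℝ) ∈ Γ.strictPeriods)
    {f : ModularForm Γ k} (hf : ∀ n, (qExpansion Γ.strictWidthInfty f).coeff n ∈ K) (n : ℕ) :
    (qExpansion N f).coeff n ∈ K := by
  obtain ⟨t, ht, htN⟩ := exists_natCast_eq_mul_strictWidthInfty hN
  rw [htN, qExpansion_natCast_mul_coeff f Γ.strictWidthInfty_pos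
    Γ.strictWidthInfty_mem_strictPeriods ht, spreadCoeff]
  split_ifs
  exacts [hf _, K.zero_mem]

lemma hasSum_qExpansion_natCast_div_cpow (hN : (N : ℝ) ∈ Γ.strictPeriods) (hk : 0 < k)
    (f : ModularForm Γ k) {s : ℂ} (hs : k + 1 < s.re) :
    HasSum (fun n : ℕ => (qExpansion N f).coeff n / (n : ℂ) ^ s)
      ((N : ℂ) ^ (-s) * ModularForm.L hk f s) := by
  obtain ⟨t, ht, htN⟩ := exists_natCast_eq_mul_strictWidthInfty hN
  have hNs : (N : ℂ) ^ (-s) = (t : ℂ) ^ (-s) * (Γ.strictWidthInfty : ℂ) ^ (-s) := by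
    rw [← ofReal_natCast N, htN, ofReal_mul, mul_cpow_ofReal_nonneg (Nat.cast_nonneg t)
      Γ.strictWidthInfty_nonneg, ofReal_natCast]
  rw [hNs, mul_assoc, htN]
  simp only [qExpansion_natCast_mul_coeff f Γ.strictWidthInfty_pos
    Γ.strictWidthInfty_mem_strictPeriods ht, div_eq_mul_inv]
  rw [hasSum_spreadCoeff_mul_iff (u := fun n => ((n : ℂ) ^ s)⁻¹) ht]
  refine ((ModularForm.hasSum_L hk f hs).mul_left ((t : ℂ) ^ (-s))).congr_fun fun n => ?_
  rw [Nat.cast_mul, natCast_mul_natCast_cpow, cpow_neg, mul_inv]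
  ring

end Width

section Continuation

variable {N k : ℕ} [NeZero N]

lemma LSeriesHasSum_mul_pow {a : ℕ → ℂ} {s S : ℂ} (j : ℕ)
    (h : LSeriesHasSum a (s - j) S) : LSeriesHasSum (fun n => a n * (n : ℂ) ^ j) s S := by
  refine HasSum.congr_fun h fun n => ?_
  rcases eq_or_ne n 0 with rfl | hn
  · simp
  · have hn' : (n : ℂ) ≠ 0 := Nat.cast_ne_zero.mpr hn
    rw [LSeries.term_of_ne_zero hn, LSeries.term_of_ne_zero hn, cpow_sub _ _ hn', cpow_natCast]
    field_simp

lemma LSeriesHasSum_LFunction (Φ : ZMod N → ℂ) {s : ℂ} (hs : 1 < s.re) :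
    LSeriesHasSum (fun n => Φ n) s (LFunction Φ s) :=
  LFunction_eq_LSeries Φ hs ▸ (LSeriesSummable_of_one_lt_re Φ hs).LSeriesHasSum

/-- The continuation of the Dirichlet series `∑ twistedSigma (k - 1) φ n / n ^ s`, bilinear in the
`L`-functions of the two variables of `φ`. -/
def bilinearL (k : ℕ) (φ : ZMod N → ZMod N → ℂ) (s : ℂ) : ℂ :=
  ∑ x, ∑ y, φ x y * (LFunction (Pi.single x 1) s * LFunction (Pi.single y 1) (s - (k - 1 : ℕ)))

lemma LSeriesHasSum_bilinearL (φ : ZMod N → ZMod N → ℂ) {s : ℂ} (hs : k + 1 < s.re) :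
    LSeriesHasSum (twistedSigma (k - 1) φ) s (bilinearL k φ s) := by
  have hs₁ : 1 < s.re := by linarith [Nat.cast_nonneg (α := ℝ) k]
  have hs₂ : 1 < (s - (k - 1 : ℕ)).re := by
    have hle : ((k - 1 : ℕ) : ℝ) ≤ k := Nat.cast_le.mpr (Nat.sub_le k 1)
    rw [sub_re, natCast_re]
    linarith
  have hconv (x y : ZMod N) := (LSeriesHasSum_LFunction (Pi.single x 1) hs₁).convolution
    (LSeriesHasSum_mul_pow (k - 1) (LSeriesHasSum_LFunction (Pi.single y 1) hs₂))
  refine HasSum.congr_fun (hasSum_sum (s := Finset.univ) fun x _ =>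
    hasSum_sum (s := Finset.univ) fun y _ => (hconv x y).mul_left (φ x y)) fun n => ?_
  rcases eq_or_ne n 0 with rfl | hn
  · simp
  simp only [LSeries.term_of_ne_zero hn, LSeries.convolution_def, mul_div_assoc', ← Finset.sum_div,
    Finset.mul_sum, twistedSigma]
  congr 1
  rw [Finset.sum_congr rfl fun x _ => Finset.sum_comm, Finset.sum_comm]
  refine Finset.sum_congr rfl fun p _ => ?_
  simp [Pi.single_apply]

lemma differentiableAt_bilinearL (hk : k ≠ 0) (φ : ZMod N → ZMod N → ℂ) {s : ℂ} (hs₁ : s ≠ 1)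
    (hsk : s ≠ k) : DifferentiableAt ℂ (bilinearL k φ) s := by
  have hne : s - (k - 1 : ℕ) ≠ 1 := fun h => hsk (by
    rw [Nat.cast_pred (Nat.pos_of_ne_zero hk)] at h
    linear_combination h)
  refine .fun_sum fun x _ => .fun_sum fun y _ => .const_mul (.mul ?_ ?_) _
  · exact differentiableAt_LFunction _ _ (.inl hs₁)
  · exact (differentiableAt_LFunction (Pi.single y 1) (s - (k - 1 : ℕ)) (.inl hne)).comp
      (f := fun s : ℂ => s - (k - 1 : ℕ)) s (by fun_prop)

lemma isStrongFEPair_weakFEPair_of_isZeroAt {Γ : Subgroup SL(2, ℤ)} [Γ.FiniteIndex] {k : ℤ}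
    (hk : 0 < k) {f : ModularForm (Γ : Subgroup (GL (Fin 2) ℝ)) k}
    (h0 : OnePoint.IsZeroAt ((0 : ℝ) : OnePoint ℝ) f k)
    (hinf : OnePoint.IsZeroAt OnePoint.infty f k) :
    IsStrongFEPair (ModularForm.weakFEPair hk f) where
  hf₀ := (OnePoint.isZeroAt_infty_iff.mp hinf).valueAtInfty_eq_zero
  hg₀ := IsZeroAtImInfty.valueAtInfty_eq_zero <| h0 ModularGroup.S <| by
    rw [OnePoint.smul_infty_eq_ite]
    simp [ModularGroup.coe_S]

lemma differentiable_L_of_isZeroAt {Γ : Subgroup SL(2, ℤ)} [Γ.FiniteIndex] {k : ℤ} (hk : 0 < k)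
    {f : ModularForm (Γ : Subgroup (GL (Fin 2) ℝ)) k}
    (h0 : OnePoint.IsZeroAt ((0 : ℝ) : OnePoint ℝ) f k)
    (hinf : OnePoint.IsZeroAt OnePoint.infty f k) :
    Differentiable ℂ (ModularForm.L hk f) := by
  have hΛ : Differentiable ℂ (ModularForm.Λ hk f) :=
    (isStrongFEPair_weakFEPair_of_isZeroAt hk h0 hinf).differentiable_Λ
  unfold ModularForm.L
  simp only [div_eq_mul_inv]
  fun_prop

lemma eq_of_eqOn_re_gt {F G : ℂ → ℂ} {S : Set ℂ} (hS : S.Finite)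
    (hF : DifferentiableOn ℂ F Sᶜ) (hG : DifferentiableOn ℂ G Sᶜ) {c : ℝ}
    (hFG : ∀ s, c < s.re → F s = G s) {s : ℂ} (hs : s ∉ S) : F s = G s := by
  have hopen : IsOpen Sᶜ := hS.isClosed.isOpen_compl
  have hconn : IsPreconnected Sᶜ := (hS.countable.isConnected_compl_of_one_lt_rank
    (by simp [rank_real_complex])).isPreconnected
  obtain ⟨x, hxS, hx⟩ : ∃ x : ℝ, (x : ℂ) ∉ S ∧ c < x := by
    obtain ⟨x, hx, hxS⟩ := (Set.Ioi_infinite c).exists_notMem_finite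
      (hS.preimage ofReal_injective.injOn)
    exact ⟨x, hxS, hx⟩
  refine (hF.analyticOnNhd hopen).eqOn_of_preconnected_of_eventuallyEq (hG.analyticOnNhd hopen)
    hconn hxS ?_ hs
  filter_upwards [(isOpen_lt continuous_const Complex.continuous_re).mem_nhds
    (show c < (x : ℂ).re from hx)] with z hz using hFG z hz

theorem exists_natCast_cpow_mul_L_eq_bilinearL {K : IntermediateField ℚ ℂ}
    {Γ : Subgroup SL(2, ℤ)} [Γ.FiniteIndex] (hk : 3 ≤ k) (hk₀ : 0 < (k : ℤ))
    (hN : (N : ℝ) ∈ (Γ : Subgroup (GL (Fin 2) ℝ)).strictPeriods)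
    {f : ModularForm (Γ : Subgroup (GL (Fin 2) ℝ)) k} (hf : f ∈ eisensteinZeroInfty K Γ N k) :
    ∃ φ : ZMod N → ZMod N → ℂ, (∀ x y, φ x y ∈ K) ∧
      (∀ x y, φ (-x) (-y) = (-1) ^ k * φ x y) ∧
      ∀ s : ℂ, s ≠ 1 → s ≠ k → (N : ℂ) ^ (-s) * ModularForm.L hk₀ f s = bilinearL k φ s := by
  obtain ⟨hE, h0, hinf, hcoeff⟩ := hf
  obtain ⟨φ, hφ, hφcoeff⟩ := qExpansion_coeff_eq_twistedSigma hk hN hE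
  obtain ⟨φ', hK, hφ', hφφ'⟩ := exists_mem_twistedSigma_eq (K := K) (l := k - 1) hφ fun n => by
    rcases eq_or_ne n 0 with rfl | hn
    · simp [twistedSigma]
    · exact hφcoeff n hn ▸ qExpansion_natCast_coeff_mem hN hcoeff n
  refine ⟨φ', hK, hφ', fun s hs₁ hsk =>
    eq_of_eqOn_re_gt (F := fun s => (N : ℂ) ^ (-s) * ModularForm.L hk₀ f s)
      (S := {1, (k : ℂ)}) (Set.toFinite _)
      (Differentiable.differentiableOn ?_) (fun z hz => ?_) (c := k + 1) (fun z hz => ?_)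
      (by simp [hs₁, hsk])⟩
  · have hL := differentiable_L_of_isZeroAt hk₀ h0 hinf
    fun_prop (disch := simp [NeZero.ne N])
  · have hz' : z ≠ 1 ∧ z ≠ k := by simpa using hz
    exact (differentiableAt_bilinearL (by omega) φ' hz'.1 hz'.2).differentiableWithinAt
  · have hz₀ : z ≠ 0 := by
      rintro rfl
      rw [zero_re] at hz
      linarith [Nat.cast_nonneg (α := ℝ) k]
    refine (hasSum_qExpansion_natCast_div_cpow hN hk₀ f (by exact_mod_cast hz)).unique
      (HasSum.congr_fun (LSeriesHasSum_bilinearL φ' hz) fun n => ?_)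
    rcases eq_or_ne n 0 with rfl | hn
    · simp [hz₀]
    · rw [LSeries.term_of_ne_zero hn, hφcoeff n hn, hφφ']

end Continuation

section HurwitzZetaOddOne

lemma abs_rpow_neg_sub_rpow_neg_le {a b c s : ℝ} (hc : 0 < c) (hs : 0 ≤ s) (ha : c ≤ a)
    (hb : c ≤ b) : |a ^ (-s) - b ^ (-s)| ≤ s * c ^ (-s - 1) * |a - b| := by
  refine (convex_Ici c).norm_image_sub_le_of_norm_hasDerivWithin_le
    (f := fun y => y ^ (-s)) (f' := fun y => -s * y ^ (-s - 1))
    (fun y hy => ?_) (fun y hy => ?_) hb ha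
  · exact (Real.hasDerivAt_rpow_const (.inl (hc.trans_le hy).ne')).hasDerivWithinAt
  · have hy₀ : 0 < y := hc.trans_le hy
    rw [norm_mul, norm_neg, Real.norm_of_nonneg hs,
      Real.norm_of_nonneg (Real.rpow_nonneg hy₀.le _)]
    gcongr s * ?_
    exact Real.rpow_le_rpow_of_nonpos hc hy (by linarith)

/-- The terms of the Dirichlet series of `hurwitzZetaOdd x` at the real point `s`, the two residue
classes `x` and `1 - x` being paired so that the series still converges at `s = 1`. -/
def hurwitzOddTerm (x s : ℝ) (n : ℕ) : ℝ := ((n + x) ^ (-s) - (n + (1 - x)) ^ (-s)) / 2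

variable {x : ℝ}

lemma abs_hurwitzOddTerm_le (hx : x ∈ Set.Ioo 0 1) {s : ℝ} (hs : s ∈ Set.Icc 1 2) (n : ℕ) :
    |hurwitzOddTerm x s n| ≤ (x * (1 - x)) ^ (-3 : ℝ) * (1 / ((n : ℝ) + 1) ^ 2) := by
  obtain ⟨hx₀, hx₁⟩ := hx
  obtain ⟨hs₁, hs₂⟩ := hs
  set c := x * (1 - x) with hc
  have hn : (0 : ℝ) ≤ n := n.cast_nonneg
  have hc₀ : 0 < c := mul_pos hx₀ (by linarith)
  have hcx : c ≤ x := by nlinarith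
  have hcy : c ≤ 1 - x := by nlinarith
  have hcn : c * n ≤ n := mul_le_of_le_one_left hn (by linarith)
  have hgap : |n + x - (n + (1 - x))| ≤ 1 := abs_le.mpr ⟨by linarith, by linarith⟩
  have hmvt : |(n + x) ^ (-s) - (n + (1 - x)) ^ (-s)| ≤
      s * (c * (n + 1)) ^ (-s - 1) * |n + x - (n + (1 - x))| :=
    abs_rpow_neg_sub_rpow_neg_le (by positivity) (by linarith) (by linarith) (by linarith)
  have hcs : c ^ (-s - 1) ≤ c ^ (-3 : ℝ) :=
    Real.rpow_le_rpow_of_exponent_ge hc₀ (by linarith) (by linarith)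
  have hns : ((n : ℝ) + 1) ^ (-s - 1) ≤ 1 / ((n : ℝ) + 1) ^ 2 := by
    rw [one_div, ← Real.rpow_natCast, ← Real.rpow_neg (by positivity)]
    exact Real.rpow_le_rpow_of_exponent_le (by linarith) (by push_cast; linarith)
  rw [hurwitzOddTerm, abs_div, abs_two, div_le_iff₀' two_pos]
  calc |(n + x) ^ (-s) - (n + (1 - x)) ^ (-s)|
      ≤ s * (c * (n + 1)) ^ (-s - 1) * |n + x - (n + (1 - x))| := hmvt
    _ ≤ 2 * (c ^ (-3 : ℝ) * (1 / ((n : ℝ) + 1) ^ 2)) * 1 := by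
        rw [Real.mul_rpow hc₀.le (by positivity)]
        gcongr
    _ = 2 * (c ^ (-3 : ℝ) * (1 / ((n : ℝ) + 1) ^ 2)) := mul_one _

lemma summable_hurwitzOddTerm_bound (C : ℝ) :
    Summable fun n : ℕ => C * (1 / ((n : ℝ) + 1) ^ 2) :=
  .mul_left _ (by simpa using
    (summable_nat_add_iff 1).mpr (Real.summable_one_div_nat_pow.mpr one_lt_two))

lemma summable_hurwitzOddTerm_one (hx : x ∈ Set.Ioo 0 1) : Summable (hurwitzOddTerm x 1) :=
  .of_norm_bounded (summable_hurwitzOddTerm_bound _)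
    (abs_hurwitzOddTerm_le hx ⟨le_rfl, one_le_two⟩)

lemma hasSum_hurwitzOddTerm (hx : x ∈ Set.Ioo 0 1) {s : ℝ} (hs : 1 < s) :
    HasSum (fun n => (hurwitzOddTerm x s n : ℂ)) (hurwitzZetaOdd (x : UnitAddCircle) s) := by
  obtain ⟨hx₀, hx₁⟩ := hx
  refine (hasSum_nat_hurwitzZetaOdd_of_mem_Icc ⟨hx₀.le, hx₁.le⟩ (s := s)
    (by simpa using hs)).congr_fun fun n => ?_
  have hu : (0 : ℝ) ≤ n + x := by positivity
  have hv : (0 : ℝ) ≤ n + (1 - x) := add_nonneg n.cast_nonneg (by linarith)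
  rw [hurwitzOddTerm, ofReal_div, ofReal_sub, ofReal_cpow hu, ofReal_cpow hv, ofReal_neg, cpow_neg,
    cpow_neg, one_div, one_div]
  push_cast
  rw [add_sub_assoc]

lemma hurwitzZetaOdd_one_eq_tsum (hx : x ∈ Set.Ioo 0 1) :
    hurwitzZetaOdd (x : UnitAddCircle) 1 = (∑' n, hurwitzOddTerm x 1 n : ℝ) := by
  have hcont (n : ℕ) : Tendsto (hurwitzOddTerm x · n) (𝓝[>] 1) (𝓝 (hurwitzOddTerm x 1 n)) := by
    have hu : (n + x : ℝ) ≠ 0 := (add_pos_of_nonneg_of_pos n.cast_nonneg hx.1).ne'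
    have hv : (n + (1 - x) : ℝ) ≠ 0 :=
      (add_pos_of_nonneg_of_pos n.cast_nonneg (sub_pos.mpr hx.2)).ne'
    refine Tendsto.mono_left (ContinuousAt.tendsto ?_) nhdsWithin_le_nhds
    exact (((Real.continuousAt_const_rpow hu).comp continuous_neg.continuousAt).sub
      ((Real.continuousAt_const_rpow hv).comp continuous_neg.continuousAt)).div_const 2
  have hterms : Tendsto (fun s => ∑' n, hurwitzOddTerm x s n) (𝓝[>] 1)
      (𝓝 (∑' n, hurwitzOddTerm x 1 n)) := by
    refine tendsto_tsum_of_dominated_convergence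
      (bound := fun n => (x * (1 - x)) ^ (-3 : ℝ) * (1 / ((n : ℝ) + 1) ^ 2))
      (summable_hurwitzOddTerm_bound _) hcont ?_
    filter_upwards [Ioo_mem_nhdsGT one_lt_two] with s hs
    exact abs_hurwitzOddTerm_le hx ⟨hs.1.le, hs.2.le⟩
  have hzeta : Tendsto (fun s : ℝ => hurwitzZetaOdd (x : UnitAddCircle) (s : ℂ)) (𝓝[>] 1)
      (𝓝 (hurwitzZetaOdd (x : UnitAddCircle) (1 : ℝ))) :=
    (((differentiable_hurwitzZetaOdd _).continuous.comp continuous_ofReal).tendsto 1).mono_left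
      nhdsWithin_le_nhds
  rw [ofReal_one] at hzeta
  refine tendsto_nhds_unique hzeta (((continuous_ofReal.tendsto _).comp hterms).congr' ?_)
  filter_upwards [self_mem_nhdsWithin] with s hs
  rw [Function.comp_apply, ofReal_tsum, (hasSum_hurwitzOddTerm hx hs).tsum_eq]

lemma sum_range_hurwitzOddTerm_one (M : ℕ) :
    ∑ n ∈ Finset.range M, (hurwitzOddTerm x 1 n : ℂ) =
      (1 / x + ∑ n ∈ Finset.range M, (1 / ((x : ℂ) - (n + 1)) + 1 / (x + (n + 1))) -
        1 / ((M : ℂ) + x)) / 2 := by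
  induction M with
  | zero => simp
  | succ M ih =>
    have hneg : (M : ℂ) + (1 - x) = -(x - (M + 1)) := by ring
    rw [Finset.sum_range_succ, Finset.sum_range_succ, ih]
    simp only [hurwitzOddTerm, Real.rpow_neg_one]
    push_cast
    rw [hneg, add_comm (x : ℂ) ((M : ℂ) + 1), inv_neg]
    ring

theorem hurwitzZetaOdd_one (hx : x ∈ Set.Ioo 0 1) :
    hurwitzZetaOdd (x : UnitAddCircle) 1 = π / 2 * cot (π * x) := by
  have hxℤ : (x : ℂ) ∈ integerComplement := by
    rintro ⟨m, hm⟩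
    have hm' : (m : ℝ) = x := by exact_mod_cast hm
    rw [← hm'] at hx
    have h₀ : 0 < m := Int.cast_pos.mp hx.1
    have h₁ : m < 1 := by exact_mod_cast hx.2
    omega
  have hodd : Tendsto (fun M => ∑ n ∈ Finset.range M, (hurwitzOddTerm x 1 n : ℂ)) atTop
      (𝓝 (∑' n, hurwitzOddTerm x 1 n : ℝ)) :=
    (hasSum_ofReal.mpr (summable_hurwitzOddTerm_one hx).hasSum).tendsto_sum_nat
  have hcot : Tendsto
      (fun M => ∑ n ∈ Finset.range M, (1 / ((x : ℂ) - (n + 1)) + 1 / (x + (n + 1)))) atTop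
      (𝓝 (∑' n : ℕ, (1 / ((x : ℂ) - (n + 1)) + 1 / (x + (n + 1))))) :=
    (summable_cotTerm hxℤ).hasSum.tendsto_sum_nat
  have htail : Tendsto (fun M : ℕ => 1 / ((M : ℂ) + x)) atTop (𝓝 0) := by
    have hreal : Tendsto (fun M : ℕ => 1 / ((M : ℝ) + x)) atTop (𝓝 0) :=
      tendsto_const_nhds.div_atTop
        (tendsto_atTop_add_const_right _ _ tendsto_natCast_atTop_atTop)
    simpa using (continuous_ofReal.tendsto 0).comp hreal |>.congr fun M => by simp
  have hlim := (((tendsto_const_nhds (x := 1 / (x : ℂ))).add hcot).sub htail).div_const 2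
  rw [hurwitzZetaOdd_one_eq_tsum hx, tendsto_nhds_unique hodd
    (hlim.congr fun M => (sum_range_hurwitzOddTerm_one M).symm), ← cot_series_rep' hxℤ]
  ring

end HurwitzZetaOddOne

section LFunctionValues

variable {K : IntermediateField ℚ ℂ} {N : ℕ} [NeZero N]

/-- `K` contains the numbers `2 cos (2 π j / N)` and `2 sin (2 π j / N)`. -/
structure ContainsTrig (K : IntermediateField ℚ ℂ) (N : ℕ) [NeZero N] : Prop where
  cos_mem (j : ZMod N) : stdAddChar j + stdAddChar (-j) ∈ K
  sin_mem (j : ZMod N) : I * (stdAddChar j - stdAddChar (-j)) ∈ K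

lemma LFunction_const_mul (c : ℂ) (Φ : ZMod N → ℂ) (s : ℂ) :
    LFunction (fun x => c * Φ x) s = c * LFunction Φ s := by
  simp only [LFunction, mul_assoc, ← Finset.mul_sum]
  ring

lemma LFunction_add (Φ Ψ : ZMod N → ℂ) (s : ℂ) :
    LFunction (fun x => Φ x + Ψ x) s = LFunction Φ s + LFunction Ψ s := by
  simp only [LFunction, add_mul, Finset.sum_add_distrib]
  ring

/-- The discrete Fourier transform of a function of the parity of `s`, with the power of `I` that
makes it real for real functions. -/
def parityDft (s : ℕ) (Φ : ZMod N → ℂ) (x : ZMod N) : ℂ := I ^ s * 𝓕 Φ x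

variable {s : ℕ} {Φ : ZMod N → ℂ}

lemma dft_neg_of_parity (hpar : ∀ x, Φ (-x) = (-1) ^ s * Φ x) (x : ZMod N) :
    𝓕 Φ (-x) = (-1) ^ s * 𝓕 Φ x := by
  rw [← congr_fun (dft_comp_neg Φ), funext hpar, dft_const_mul]

lemma parityDft_neg (hpar : ∀ x, Φ (-x) = (-1) ^ s * Φ x) (x : ZMod N) :
    parityDft s Φ (-x) = (-1) ^ s * parityDft s Φ x := by
  rw [parityDft, dft_neg_of_parity hpar, mul_left_comm, parityDft]

lemma I_pow_mul_I_pow_mul_neg_one_pow (s : ℕ) : I ^ s * I ^ s * (-1) ^ s = 1 := by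
  rw [← mul_pow, ← mul_pow, I_mul_I, neg_mul_neg, one_mul, one_pow]

lemma parityDft_parityDft (hpar : ∀ x, Φ (-x) = (-1) ^ s * Φ x) :
    parityDft s (parityDft s Φ) = fun x => (N : ℂ) * Φ x := by
  ext x
  have hdft : parityDft s (parityDft s Φ) x = I ^ s * (I ^ s * (N * Φ (-x))) := by
    rw [parityDft, show parityDft s Φ = fun x => I ^ s * 𝓕 Φ x from rfl, dft_const_mul, dft_dft]
    rfl
  rw [hdft, hpar]
  linear_combination (N * Φ x : ℂ) * I_pow_mul_I_pow_mul_neg_one_pow s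

lemma ContainsTrig.I_pow_mul_mem (hK : ContainsTrig K N) (s : ℕ) (j : ZMod N) :
    I ^ s * (stdAddChar (-j) + (-1) ^ s * stdAddChar j) ∈ K := by
  have hsign (n : ℕ) : (-1 : ℂ) ^ n ∈ K := pow_mem (neg_mem (one_mem K)) n
  obtain ⟨n, rfl | rfl⟩ := s.even_or_odd'
  · rw [pow_mul, I_sq, pow_mul, neg_one_sq, one_pow, one_mul, add_comm]
    exact mul_mem (hsign n) (hK.cos_mem j)
  · rw [pow_succ, pow_mul, I_sq, pow_succ, pow_mul, neg_one_sq, one_pow, one_mul]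
    convert mul_mem (hsign n) (neg_mem (hK.sin_mem j)) using 1
    ring

lemma ContainsTrig.parityDft_mem (hK : ContainsTrig K N) (hΦ : ∀ x, Φ x ∈ K)
    (hpar : ∀ x, Φ (-x) = (-1) ^ s * Φ x) (x : ZMod N) : parityDft s Φ x ∈ K := by
  have hneg : 𝓕 Φ x = ∑ j : ZMod N, stdAddChar (j * x) * ((-1) ^ s * Φ j) := by
    rw [dft_apply]
    exact Fintype.sum_equiv (Equiv.neg _) _ _ fun j => by simp [← hpar]
  have hsymm : parityDft s Φ x = 2⁻¹ * ∑ j : ZMod N,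
      I ^ s * (stdAddChar (-(j * x)) + (-1) ^ s * stdAddChar (j * x)) * Φ j := by
    calc parityDft s Φ x = 2⁻¹ * (I ^ s * (𝓕 Φ x + 𝓕 Φ x)) := by rw [parityDft]; ring
      _ = _ := by
        nth_rewrite 2 [hneg]
        rw [dft_apply, ← Finset.sum_add_distrib, Finset.mul_sum]
        refine congrArg _ (Finset.sum_congr rfl fun j _ => ?_)
        rw [smul_eq_mul]
        ring
  rw [hsymm]
  exact mul_mem (inv_mem (natCast_mem K 2))
    (sum_mem fun j _ => mul_mem (hK.I_pow_mul_mem s _) (hΦ j))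

lemma stdAddChar_eq_exp_val (j : ZMod N) : stdAddChar j = cexp (j.val * (2 * π / N) * I) := by
  rw [stdAddChar_apply, toCircle_apply]
  congr 1
  ring

lemma cot_pi_mul_val_div (j : ZMod N) :
    cot (π * ((j.val / N : ℝ) : ℂ)) = -(I * (stdAddChar j - stdAddChar (-j))) /
      (2 - (stdAddChar j + stdAddChar (-j))) := by
  have hexp : cexp (2 * π * I * ((j.val / N : ℝ) : ℂ)) = stdAddChar j := by
    rw [stdAddChar_eq_exp_val]
    push_cast
    congr 1
    ring
  rw [cot_pi_eq_exp_ratio, hexp, AddChar.map_neg_eq_inv]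
  rcases eq_or_ne (stdAddChar j : ℂ) 1 with hone | hone
  · simp [hone]
  have hne : (stdAddChar j : ℂ) ≠ 0 := fun h => by simpa [h] using AddChar.norm_apply stdAddChar j
  set e : ℂ := stdAddChar j
  have hsub : 1 - e ≠ 0 := sub_ne_zero.mpr hone.symm
  have hsub' : e - 1 ≠ 0 := sub_ne_zero.mpr hone
  have hden : 2 - (e + e⁻¹) = -(e - 1) ^ 2 / e := by
    field_simp
    ring
  have hnum : e - e⁻¹ = (e - 1) * (e + 1) / e := by
    field_simp
    ring
  rw [hden, hnum]
  field_simp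
  rw [I_sq]
  ring

lemma ContainsTrig.cot_mem (hK : ContainsTrig K N) (j : ZMod N) :
    cot (π * ((j.val / N : ℝ) : ℂ)) ∈ K :=
  cot_pi_mul_val_div j ▸
    div_mem (neg_mem (hK.sin_mem j)) (sub_mem (natCast_mem K 2) (hK.cos_mem j))

lemma LFunction_one_of_odd (hΦ : Φ.Odd) :
    LFunction Φ 1 = (N : ℂ)⁻¹ * (∑ j, Φ j * (cot (π * ((j.val / N : ℝ) : ℂ)) / 2)) * π := by
  rw [LFunction_def_odd hΦ, cpow_neg_one, mul_assoc, Finset.sum_mul]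
  congr 1
  refine Finset.sum_congr rfl fun j _ => ?_
  rcases eq_or_ne j 0 with rfl | hj
  · simp [hΦ.map_zero]
  have hN : (0 : ℝ) < N := Nat.cast_pos.mpr (NeZero.pos N)
  have hjpos : 0 < j.val := Nat.pos_of_ne_zero ((ZMod.val_ne_zero j).mpr hj)
  rw [toAddCircle_apply, hurwitzZetaOdd_one ⟨by positivity, (div_lt_one hN).mpr
    (Nat.cast_lt.mpr j.val_lt)⟩]
  ring

lemma exists_LFunction_one_eq (hK : ContainsTrig K N) (hmem : ∀ x, Φ x ∈ K) (hΦ : Φ.Odd) :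
    ∃ c ∈ K, LFunction Φ 1 = c * π :=
  ⟨_, mul_mem (inv_mem (natCast_mem K N)) (sum_mem fun j _ => mul_mem (hmem j)
    (div_mem (hK.cot_mem j) (natCast_mem K 2))), LFunction_one_of_odd hΦ⟩

lemma exp_pi_mul_I_mul_natCast_div_two (s : ℕ) : cexp (π * I * s / 2) = I ^ s := by
  conv_rhs => rw [← exp_pi_div_two_mul_I, ← Complex.exp_nat_mul]
  congr 1
  ring

lemma exp_neg_pi_mul_I_mul_natCast_div_two (s : ℕ) :
    cexp (-π * I * s / 2) = (-1) ^ s * I ^ s := by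
  rw [← mul_pow, neg_one_mul, ← exp_neg_pi_div_two_mul_I, ← Complex.exp_nat_mul]
  congr 1
  ring

lemma natCast_ne_neg_natCast {m : ℕ} (hm : m ≠ 0) (n : ℕ) : (m : ℂ) ≠ -n := fun h =>
  hm (Nat.eq_zero_of_add_eq_zero_right (m := n) <| by
    exact_mod_cast (by linear_combination h : (m : ℂ) + n = 0))

lemma Gamma_natCast {m : ℕ} (hm : m ≠ 0) : Gamma (m : ℂ) = (m - 1).factorial := by
  rw [← Complex.Gamma_nat_eq_factorial, Nat.cast_pred (by omega), sub_add_cancel]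

lemma LFunction_one_sub_natCast (hs : 1 ≤ s) (hpar : ∀ x, Φ (-x) = (-1) ^ s * Φ x) :
    LFunction Φ (1 - s) = 2 * N ^ (s - 1) * (s - 1).factorial / (2 * π) ^ s *
      LFunction (parityDft s Φ) s := by
  have hpole : Φ 0 = 0 ∨ (s : ℂ) ≠ 1 := by
    refine or_iff_not_imp_right.mpr fun h => ?_
    have hs₁ : s = 1 := Nat.cast_eq_one.mp (not_not.mp h)
    have hneg := hpar 0
    rw [hs₁, neg_zero] at hneg
    linear_combination hneg / 2
  have hsign : (-1 : ℂ) ^ s * (-1) ^ s = 1 := by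
    rw [← mul_pow, neg_mul_neg, one_mul, one_pow]
  rw [LFunction_one_sub Φ (natCast_ne_neg_natCast (by omega)) hpole, funext hpar, dft_const_mul,
    show parityDft s Φ = fun x => I ^ s * 𝓕 Φ x from rfl, LFunction_const_mul,
    LFunction_const_mul, exp_pi_mul_I_mul_natCast_div_two, exp_neg_pi_mul_I_mul_natCast_div_two,
    Gamma_natCast (by omega), cpow_neg, cpow_natCast,
    show (s : ℂ) - 1 = (s - 1 : ℕ) by rw [Nat.cast_sub hs, Nat.cast_one], cpow_natCast]
  linear_combination (N ^ (s - 1) * ((2 * π) ^ s)⁻¹ * (s - 1).factorial * I ^ s *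
    LFunction (𝓕 Φ) s) * hsign

lemma LFunction_natCast_of_parity (hs : 1 ≤ s) (hpar : ∀ x, Φ (-x) = (-1) ^ s * Φ x) :
    LFunction Φ s = (2 * π) ^ s / (2 * N ^ s * (s - 1).factorial) *
      LFunction (parityDft s Φ) (1 - s) := by
  have hN : (N : ℂ) ≠ 0 := NeZero.ne _
  have hfact : ((s - 1).factorial : ℂ) ≠ 0 := Nat.cast_ne_zero.mpr (Nat.factorial_ne_zero _)
  rw [LFunction_one_sub_natCast hs (parityDft_neg hpar), parityDft_parityDft hpar,
    LFunction_const_mul, ← pow_sub_one_mul (by omega : s ≠ 0) (N : ℂ)]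
  field_simp

lemma LFunction_neg_natCast_mem {n : ℕ} (hn : n ≠ 0) (hΦ : ∀ x, Φ x ∈ K) :
    LFunction Φ (-n) ∈ K := by
  rw [LFunction, neg_neg, cpow_natCast]
  refine mul_mem (pow_mem (natCast_mem K N) n) (sum_mem fun j _ => mul_mem (hΦ j) ?_)
  have hN : (0 : ℝ) < N := Nat.cast_pos.mpr (NeZero.pos N)
  have hrat : ((j.val / N : ℝ) : ℂ) = algebraMap ℚ ℂ (j.val / N) := by
    rw [eq_ratCast]
    push_cast
    rfl
  rw [toAddCircle_apply, hurwitzZeta_neg_nat hn ⟨by positivity, (div_le_one hN).mpr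
    (Nat.cast_le.mpr j.val_lt.le)⟩, hrat, Polynomial.eval_map_algebraMap,
    Polynomial.aeval_algebraMap_apply]
  exact mul_mem (div_mem (neg_mem (one_mem K)) (add_mem (natCast_mem K n) (one_mem K)))
    (K.algebraMap_mem _)

lemma LFunction_zero_mem_of_odd (hK : ContainsTrig K N) (hmem : ∀ x, Φ x ∈ K) (hΦ : Φ.Odd) :
    LFunction Φ 0 ∈ K := by
  have hpar (x : ZMod N) : Φ (-x) = (-1) ^ 1 * Φ x := by rw [hΦ, pow_one, neg_one_mul]
  obtain ⟨c, hc, hval⟩ := exists_LFunction_one_eq hK (hK.parityDft_mem hmem hpar)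
    fun x => by rw [parityDft_neg hpar, pow_one, neg_one_mul]
  have hzero := LFunction_one_sub_natCast le_rfl hpar
  have hπ : (π : ℂ) ≠ 0 := ofReal_ne_zero.mpr Real.pi_ne_zero
  rw [Nat.cast_one, sub_self, hval] at hzero
  have hvalue : LFunction Φ 0 = c := by
    rw [hzero, tsub_self, pow_zero, Nat.factorial_zero, Nat.cast_one, pow_one]
    field_simp
  rwa [hvalue]

lemma LFunction_one_sub_natCast_mem (hK : ContainsTrig K N) {m : ℕ} (hm : 1 ≤ m)
    (hΦ : ∀ x, Φ x ∈ K) (hpar : ∀ x, Φ (-x) = (-1) ^ s * Φ x) : LFunction Φ (1 - m) ∈ K := by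
  rcases hm.eq_or_lt with rfl | hm
  · rw [Nat.cast_one, sub_self]
    rcases s.even_or_odd with hs | hs
    · rw [LFunction_apply_zero_of_even (fun x => by rw [hpar, hs.neg_one_pow, one_mul])]
      exact div_mem (neg_mem (hΦ 0)) (natCast_mem K 2)
    · exact LFunction_zero_mem_of_odd hK hΦ fun x => by
        rw [hpar, hs.neg_one_pow, neg_one_mul]
  · rw [← neg_sub (m : ℂ) 1, ← Nat.cast_pred (by omega)]
    exact LFunction_neg_natCast_mem (by omega) hΦ

lemma exists_LFunction_natCast_eq (hK : ContainsTrig K N) (hs : 1 ≤ s) (hΦ : ∀ x, Φ x ∈ K)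
    (hpar : ∀ x, Φ (-x) = (-1) ^ s * Φ x) : ∃ c ∈ K, LFunction Φ s = c * (2 * π) ^ s := by
  refine ⟨_, mul_mem (inv_mem (mul_mem (mul_mem (natCast_mem K 2) (pow_mem (natCast_mem K N) s))
    (natCast_mem K (s - 1).factorial)))
    (LFunction_one_sub_natCast_mem hK hs (hK.parityDft_mem hΦ hpar) (parityDft_neg hpar)), ?_⟩
  rw [LFunction_natCast_of_parity hs hpar, div_eq_mul_inv]
  push_cast
  ring

end LFunctionValues

section ValueSpan

variable {K : IntermediateField ℚ ℂ} {N : ℕ} [NeZero N]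

lemma hasDerivAt_functionalEquation_factor (m : ℕ) :
    HasDerivAt (fun w : ℂ => cexp (π * I * w / 2) + (-1) ^ (m + 1) * cexp (-π * I * w / 2))
      (π * I ^ (m + 1)) m := by
  have hlinear (c : ℂ) : HasDerivAt (fun w : ℂ => c * w / 2) (c / 2) (m : ℂ) := by
    simpa using ((hasDerivAt_id (m : ℂ)).const_mul c).div_const 2
  refine ((hlinear (π * I)).cexp.add ((hlinear (-π * I)).cexp.const_mul _)).congr_deriv ?_
  rw [exp_pi_mul_I_mul_natCast_div_two, exp_neg_pi_mul_I_mul_natCast_div_two]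
  have hsign : (-1 : ℂ) ^ m * (-1) ^ m = 1 := by rw [← mul_pow, neg_mul_neg, one_mul, one_pow]
  linear_combination π * I ^ (m + 1) / 2 * hsign

lemma functionalEquation_factor_eq_zero (m : ℕ) :
    cexp (π * I * m / 2) + (-1) ^ (m + 1) * cexp (-π * I * m / 2) = 0 := by
  have hsign : (-1 : ℂ) ^ m * (-1) ^ m = 1 := by rw [← mul_pow, neg_mul_neg, one_mul, one_pow]
  rw [exp_pi_mul_I_mul_natCast_div_two, exp_neg_pi_mul_I_mul_natCast_div_two]
  linear_combination -I ^ m * hsign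

lemma differentiableAt_functionalEquation_cofactor (Φ : ZMod N → ℂ) {w : ℂ}
    (hpole : ∀ n : ℕ, w ≠ -n) (hw : w ≠ 1) :
    DifferentiableAt ℂ (fun w : ℂ => N ^ (w - 1) * (2 * π) ^ (-w) * Gamma w * LFunction Φ w) w := by
  have hπ : (2 * π : ℂ) ≠ 0 := mul_ne_zero two_ne_zero (ofReal_ne_zero.mpr Real.pi_ne_zero)
  have hLFunction := differentiableAt_LFunction Φ w (.inl hw)
  fun_prop (disch := simp [hπ])

lemma LFunction_one_sub_of_parity {Φ : ZMod N → ℂ} {s : ℕ}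
    (hpar : ∀ x, Φ (-x) = (-1) ^ s * Φ x) {w : ℂ} (hpole : ∀ n : ℕ, w ≠ -n) (hw : w ≠ 1) :
    LFunction Φ (1 - w) = N ^ (w - 1) * (2 * π) ^ (-w) * Gamma w * LFunction (𝓕 Φ) w *
      (cexp (π * I * w / 2) + (-1) ^ s * cexp (-π * I * w / 2)) := by
  rw [LFunction_one_sub Φ hpole (.inr hw), funext hpar, dft_const_mul, LFunction_const_mul]
  ring

/- At a trivial zero only the exponential factor of the functional equation vanishes, and it does so
to first order. -/
lemma hasDerivAt_LFunction_one_sub_natCast {Φ : ZMod N → ℂ} {m : ℕ} (hm : 2 ≤ m)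
    (hpar : ∀ x, Φ (-x) = (-1) ^ (m + 1) * Φ x) :
    HasDerivAt (LFunction Φ) (-(N ^ (m - 1) * (m - 1).factorial / (2 * (2 * π) ^ (m - 1)) *
      LFunction (parityDft (m + 1) Φ) m)) (1 - m) := by
  have hpole : ∀ n : ℕ, (m : ℂ) ≠ -n := natCast_ne_neg_natCast (by omega)
  have hm₁ : (m : ℂ) ≠ 1 := by exact_mod_cast (by omega : m ≠ 1)
  have hreflected : HasDerivAt (fun w : ℂ => LFunction Φ (1 - w))
      (N ^ (m - 1) * (m - 1).factorial / (2 * (2 * π) ^ (m - 1)) *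
        LFunction (parityDft (m + 1) Φ) m) m := by
    refine (((differentiableAt_functionalEquation_cofactor (𝓕 Φ) hpole hm₁).hasDerivAt.mul
      (hasDerivAt_functionalEquation_factor m)).congr_of_eventuallyEq ?_).congr_deriv ?_
    · have hre : ∀ᶠ w : ℂ in 𝓝 m, 1 < w.re :=
        Complex.continuous_re.continuousAt.eventually_const_lt (by
          rw [natCast_re]
          exact_mod_cast hm)
      filter_upwards [hre] with w hw
      refine LFunction_one_sub_of_parity hpar (fun n h => ?_) (fun h => ?_)
      · rw [h, neg_re, natCast_re] at hw
        linarith [Nat.cast_nonneg (α := ℝ) n]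
      · rw [h, one_re] at hw
        exact lt_irrefl _ hw
    · have hπ : (π : ℂ) ≠ 0 := ofReal_ne_zero.mpr Real.pi_ne_zero
      rw [functionalEquation_factor_eq_zero, mul_zero, zero_add, Gamma_natCast (by omega),
        show parityDft (m + 1) Φ = fun x => I ^ (m + 1) * 𝓕 Φ x from rfl, LFunction_const_mul,
        ← Nat.cast_pred (by omega), cpow_natCast, cpow_neg, cpow_natCast,
        ← pow_sub_one_mul (by omega : m ≠ 0) (2 * π : ℂ)]
      field_simp
  have hsub : HasDerivAt (fun z : ℂ => 1 - z) (-1) (1 - m : ℂ) :=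
    (hasDerivAt_id _).const_sub 1
  rw [← sub_sub_cancel 1 (m : ℂ)] at hreflected
  simpa [Function.comp_def] using hreflected.comp _ hsub

lemma LFunction_one_sub_natCast_eq_zero {Φ : ZMod N → ℂ} {m : ℕ} (hm : 2 ≤ m)
    (hpar : ∀ x, Φ (-x) = (-1) ^ (m + 1) * Φ x) : LFunction Φ (1 - m) = 0 := by
  rw [LFunction_one_sub_of_parity hpar (natCast_ne_neg_natCast (by omega))
    (by exact_mod_cast (by omega : m ≠ 1)), functionalEquation_factor_eq_zero, mul_zero]

/-- The `K`-span of `π ^ (k - 1)` and of the values at `k - 1` of the `L`-functions of the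
`K`-valued functions on `ℤ/N` of parity `(-1) ^ k`; it contains all the periods of the Eisenstein
series in question. -/
def valueSpan (K : IntermediateField ℚ ℂ) (N : ℕ) [NeZero N] (k : ℕ) : Submodule K ℂ :=
  Submodule.span K ({(π : ℂ) ^ (k - 1)} ∪ {z | ∃ Φ : ZMod N → ℂ, (∀ x, Φ x ∈ K) ∧
    (∀ x, Φ (-x) = (-1) ^ k * Φ x) ∧ z = LFunction Φ (k - 1 : ℕ)})

lemma mul_mem_submodule_of_mem {M : Submodule K ℂ} {c z : ℂ} (hc : c ∈ K) (hz : z ∈ M) :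
    c * z ∈ M :=
  M.smul_mem (⟨c, hc⟩ : K) hz

variable {k s : ℕ}

lemma pi_pow_mem_valueSpan : (π : ℂ) ^ (k - 1) ∈ valueSpan K N k :=
  Submodule.subset_span (.inl rfl)

lemma LFunction_mem_valueSpan {Φ : ZMod N → ℂ} (hΦ : ∀ x, Φ x ∈ K)
    (hpar : ∀ x, Φ (-x) = (-1) ^ k * Φ x) : LFunction Φ (k - 1 : ℕ) ∈ valueSpan K N k :=
  Submodule.subset_span (.inr ⟨Φ, hΦ, hpar, rfl⟩)

/-- `F` has a limit at `s` (where it may be undefined) which becomes an element of `valueSpan` when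
multiplied by `(2 π) ^ (k - 1 - s)`, the normalization of the periods. -/
def HasLimitInValueSpan (K : IntermediateField ℚ ℂ) (N : ℕ) [NeZero N] (k s : ℕ)
    (F : ℂ → ℂ) : Prop :=
  ∃ ℓ : ℂ, Tendsto F (𝓝[≠] (s : ℂ)) (𝓝 ℓ) ∧ (2 * π : ℂ) ^ (k - 1 - s) * ℓ ∈ valueSpan K N k

lemma HasLimitInValueSpan.const_mul {c : ℂ} {F : ℂ → ℂ} (hc : c ∈ K)
    (hF : HasLimitInValueSpan K N k s F) : HasLimitInValueSpan K N k s (fun z => c * F z) := by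
  obtain ⟨ℓ, hℓ, hmem⟩ := hF
  exact ⟨c * ℓ, hℓ.const_mul c, mul_left_comm c _ ℓ ▸ mul_mem_submodule_of_mem hc hmem⟩

lemma HasLimitInValueSpan.sum {ι : Type*} {t : Finset ι} {F : ι → ℂ → ℂ}
    (hF : ∀ i ∈ t, HasLimitInValueSpan K N k s (F i)) :
    HasLimitInValueSpan K N k s (fun z => ∑ i ∈ t, F i z) := by
  choose! ℓ hℓ hmem using hF
  exact ⟨∑ i ∈ t, ℓ i, tendsto_finsetSum t hℓ, Finset.mul_sum t ℓ _ ▸ sum_mem hmem⟩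

lemma natCast_sub_natCast_pred (hsk : s ≤ k - 1) (hk : k ≠ 0) :
    (s : ℂ) - (k - 1 : ℕ) = 1 - (k - s : ℕ) := by
  rw [Nat.cast_pred (by omega), Nat.cast_sub (by omega)]
  ring

lemma HasLimitInValueSpan.of_continuousAt {A B : ZMod N → ℂ} (hsk : s ≤ k - 1) (hk : k ≠ 0)
    (hA : ContinuousAt (LFunction A) s)
    (hmem : (2 * π : ℂ) ^ (k - 1 - s) * (LFunction A s * LFunction B (1 - (k - s : ℕ))) ∈
      valueSpan K N k) :
    HasLimitInValueSpan K N k s (fun z => LFunction A z * LFunction B (z - (k - 1 : ℕ))) := by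
  have hB : ContinuousAt (fun z => LFunction B (z - (k - 1 : ℕ))) (s : ℂ) := by
    refine ContinuousAt.comp (g := LFunction B) (DifferentiableAt.continuousAt
      (differentiableAt_LFunction B _ (.inl ?_))) (by fun_prop)
    rw [natCast_sub_natCast_pred hsk hk, Ne, sub_eq_self, Nat.cast_eq_zero]
    omega
  refine ⟨_, (hA.mul hB).tendsto.mono_left nhdsWithin_le_nhds, ?_⟩
  rwa [Pi.mul_apply, natCast_sub_natCast_pred hsk hk]

lemma sum_eq_zero_of_odd {A : ZMod N → ℂ} (hA : A.Odd) : ∑ j, A j = 0 := by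
  have hneg : ∑ j, A j = -∑ j, A j := by
    rw [← Finset.sum_neg_distrib]
    exact Fintype.sum_equiv (Equiv.neg _) _ _ fun j => by rw [Equiv.neg_apply, hA, neg_neg]
  linear_combination hneg / 2

lemma hasLimitInValueSpan_of_parity (hK : ContainsTrig K N) (hs : 1 ≤ s) (hsk : s ≤ k - 1)
    {A B : ZMod N → ℂ} (hA : ∀ x, A x ∈ K) (hB : ∀ x, B x ∈ K)
    (hAs : ∀ x, A (-x) = (-1) ^ s * A x) {b : ℕ} (hBb : ∀ x, B (-x) = (-1) ^ b * B x) :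
    HasLimitInValueSpan K N k s (fun z => LFunction A z * LFunction B (z - (k - 1 : ℕ))) := by
  refine .of_continuousAt hsk (by omega) (differentiableAt_LFunction A _ ?_).continuousAt ?_
  · rcases hs.eq_or_lt with rfl | hs'
    · exact .inr (sum_eq_zero_of_odd fun x => by rw [hAs, pow_one, neg_one_mul])
    · exact .inl (by exact_mod_cast hs'.ne')
  obtain ⟨c, hc, hvalue⟩ := exists_LFunction_natCast_eq hK hs hA hAs
  have hpi : (2 * π : ℂ) ^ (k - 1 - s) * (2 * π) ^ s = 2 ^ (k - 1) * π ^ (k - 1) := by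
    rw [← pow_add, ← mul_pow, Nat.sub_add_cancel hsk]
  convert mul_mem_submodule_of_mem (mul_mem (mul_mem hc (LFunction_one_sub_natCast_mem hK
    (show 1 ≤ k - s by omega) hB hBb)) (pow_mem (natCast_mem K 2) (k - 1)))
    (pi_pow_mem_valueSpan (N := N) (k := k)) using 1
  rw [hvalue]
  push_cast
  linear_combination c * LFunction B (1 - (k - s : ℕ)) * hpi

lemma hasLimitInValueSpan_one (hK : ContainsTrig K N) (hk : 3 ≤ k) {A B : ZMod N → ℂ}
    (hA : ∀ x, A x ∈ K) (hB : ∀ x, B x ∈ K) (hBk : ∀ x, B (-x) = (-1) ^ k * B x) :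
    HasLimitInValueSpan K N k 1 (fun z => LFunction A z * LFunction B (z - (k - 1 : ℕ))) := by
  have hparity : ∀ x, B (-x) = (-1) ^ (k - 1 + 1) * B x := by
    rwa [Nat.sub_add_cancel (by omega)]
  have hderiv := (hasDerivAt_LFunction_one_sub_natCast (by omega) hparity).comp_sub_const
    (x := 1) (a := ((k - 1 : ℕ) : ℂ))
  have hzero : LFunction B (1 - (k - 1 : ℕ)) = 0 :=
    LFunction_one_sub_natCast_eq_zero (by omega) hparity
  have hlimit := ((LFunction_residue_one A).mul hderiv.tendsto_slope).congr' <| by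
    filter_upwards [self_mem_nhdsWithin] with z hz
    have hz₁ : z - 1 ≠ 0 := sub_ne_zero.mpr hz
    rw [slope_def_field, hzero, sub_zero, mul_assoc, mul_left_comm, mul_div_cancel₀ _ hz₁]
  refine ⟨_, by simpa only [Nat.cast_one] using hlimit, ?_⟩
  rw [Nat.sub_add_cancel (by omega)]
  convert mul_mem_submodule_of_mem (c := -((∑ j, A j / N) * N ^ (k - 1 - 1) *
    (k - 1 - 1).factorial / 2)) ?_ (LFunction_mem_valueSpan (hK.parityDft_mem hB hBk)
      (parityDft_neg hBk)) using 1
  · field_simp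
  · exact neg_mem (div_mem (mul_mem (mul_mem (sum_mem fun j _ => div_mem (hA j)
      (natCast_mem K N)) (pow_mem (natCast_mem K N) _)) (natCast_mem K _)) (natCast_mem K 2))

lemma hasLimitInValueSpan_of_parity_succ (hK : ContainsTrig K N) (hk : 3 ≤ k) (hs : 1 ≤ s)
    (hsk : s ≤ k - 1) {A B : ZMod N → ℂ} (hA : ∀ x, A x ∈ K) (hB : ∀ x, B x ∈ K)
    (hAs : ∀ x, A (-x) = (-1) ^ (s + 1) * A x) (hBs : ∀ x, B (-x) = (-1) ^ (k - s + 1) * B x) :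
    HasLimitInValueSpan K N k s (fun z => LFunction A z * LFunction B (z - (k - 1 : ℕ))) := by
  rcases hs.eq_or_lt with rfl | hs'
  · exact hasLimitInValueSpan_one hK hk hA hB (by rwa [Nat.sub_add_cancel (by omega)] at hBs)
  refine .of_continuousAt hsk (by omega) (differentiableAt_LFunction A _
    (.inl (by exact_mod_cast hs'.ne'))).continuousAt ?_
  rcases hsk.eq_or_lt with rfl | hsk'
  · rw [show k - (k - 1) = 1 by omega] at hBs ⊢
    rw [Nat.sub_add_cancel (by omega)] at hAs
    have hB_even : B.Even := fun x => by rw [hBs, neg_one_sq, one_mul]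
    rw [Nat.cast_one, sub_self, LFunction_apply_zero_of_even hB_even, Nat.sub_self, pow_zero,
      one_mul, mul_comm]
    exact mul_mem_submodule_of_mem (div_mem (neg_mem (hB 0)) (natCast_mem K 2))
      (LFunction_mem_valueSpan hA hAs)
  · rw [LFunction_one_sub_natCast_eq_zero (by omega) hBs, mul_zero, mul_zero]
    exact zero_mem _

lemma hasLimitInValueSpan_LFunction_mul (hK : ContainsTrig K N) (hk : 3 ≤ k) (hs : 1 ≤ s)
    (hsk : s ≤ k - 1) {a : ℕ} {A B : ZMod N → ℂ} (hA : ∀ x, A x ∈ K) (hB : ∀ x, B x ∈ K)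
    (hAa : ∀ x, A (-x) = (-1) ^ a * A x) (hBa : ∀ x, B (-x) = (-1) ^ (a + k) * B x) :
    HasLimitInValueSpan K N k s (fun z => LFunction A z * LFunction B (z - (k - 1 : ℕ))) := by
  rcases (a + s).even_or_odd with has | has
  · exact hasLimitInValueSpan_of_parity hK hs hsk hA hB
      (by rwa [neg_one_pow_congr (Nat.even_add.mp has)] at hAa) hBa
  · refine hasLimitInValueSpan_of_parity_succ hK hk hs hsk hA hB ?_ ?_
    · rwa [neg_one_pow_congr (n := s + 1) (by grind)] at hAa
    · rwa [neg_one_pow_congr (n := k - s + 1) (by grind)] at hBa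

/-- The indicator function of `x`, symmetrized to have the parity of `a`; sums of these over the two
parities decompose a bilinear form in indicator functions. -/
def signedSingle (a : ℕ) (x z : ZMod N) : ℂ :=
  Pi.single (M := fun _ => ℂ) x 1 z + (-1) ^ a * Pi.single (M := fun _ => ℂ) (-x) 1 z

omit [NeZero N] in
lemma signedSingle_mem (a : ℕ) (x z : ZMod N) : signedSingle a x z ∈ K := by
  have hsingle (y : ZMod N) : Pi.single (M := fun _ => ℂ) y 1 z ∈ K := by
    rw [Pi.single_apply]
    split_ifs
    exacts [one_mem K, zero_mem K]
  exact add_mem (hsingle x) (mul_mem (pow_mem (neg_mem (one_mem K)) a) (hsingle (-x)))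

omit [NeZero N] in
lemma signedSingle_neg (a : ℕ) (x z : ZMod N) :
    signedSingle a x (-z) = (-1) ^ a * signedSingle a x z := by
  have hsign : (-1 : ℂ) ^ a * (-1) ^ a = 1 := by rw [← mul_pow, neg_mul_neg, one_mul, one_pow]
  have hsingle (y : ZMod N) : Pi.single (M := fun _ => ℂ) y 1 (-z) =
      Pi.single (M := fun _ => ℂ) (-y) 1 z := by
    simp only [Pi.single_apply, neg_eq_iff_eq_neg]
  simp only [signedSingle, hsingle, neg_neg]
  linear_combination -Pi.single (M := fun _ => ℂ) (-x) 1 z * hsign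

lemma LFunction_signedSingle (a : ℕ) (x : ZMod N) (z : ℂ) :
    LFunction (signedSingle a x) z =
      LFunction (Pi.single x 1) z + (-1) ^ a * LFunction (Pi.single (-x) 1) z := by
  rw [show signedSingle a x = fun z => Pi.single (M := fun _ => ℂ) x 1 z +
    (-1) ^ a * Pi.single (M := fun _ => ℂ) (-x) 1 z from rfl, LFunction_add, LFunction_const_mul]

lemma bilinearL_eq_sum_signedSingle {φ : ZMod N → ZMod N → ℂ}
    (hφ : ∀ x y, φ (-x) (-y) = (-1) ^ k * φ x y) (z : ℂ) :
    bilinearL k φ z = ∑ x, ∑ y, ∑ a ∈ Finset.range 2, 4⁻¹ * φ x y *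
      (LFunction (signedSingle a x) z * LFunction (signedSingle (a + k) y) (z - (k - 1 : ℕ))) := by
  set P : ZMod N → ℂ := fun x => LFunction (Pi.single x 1) z
  set Q : ZMod N → ℂ := fun y => LFunction (Pi.single y 1) (z - (k - 1 : ℕ))
  have hreflect : bilinearL k φ z = ∑ x, ∑ y, (-1) ^ k * φ x y * (P (-x) * Q (-y)) := by
    rw [bilinearL]
    refine Fintype.sum_equiv (Equiv.neg _) _ _ fun x => ?_
    refine Fintype.sum_equiv (Equiv.neg _) _ _ fun y => ?_
    simp only [Equiv.neg_apply, ← hφ, neg_neg, P, Q]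
  calc bilinearL k φ z = 2⁻¹ * (∑ x, ∑ y, φ x y * (P x * Q y) +
        ∑ x, ∑ y, (-1) ^ k * φ x y * (P (-x) * Q (-y))) := by
        rw [← hreflect, ← bilinearL]
        ring
    _ = _ := by
        simp only [← Finset.sum_add_distrib, Finset.mul_sum]
        refine Finset.sum_congr rfl fun x _ => Finset.sum_congr rfl fun y _ => ?_
        simp only [Finset.sum_range_succ, Finset.sum_range_zero, LFunction_signedSingle, P, Q]
        ring

lemma hasLimitInValueSpan_bilinearL (hK : ContainsTrig K N) (hk : 3 ≤ k) (hs : 1 ≤ s)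
    (hsk : s ≤ k - 1) {φ : ZMod N → ZMod N → ℂ} (hφK : ∀ x y, φ x y ∈ K)
    (hφ : ∀ x y, φ (-x) (-y) = (-1) ^ k * φ x y) :
    HasLimitInValueSpan K N k s (bilinearL k φ) := by
  rw [funext (bilinearL_eq_sum_signedSingle hφ)]
  exact .sum fun x _ => .sum fun y _ => .sum fun a _ =>
    (hasLimitInValueSpan_LFunction_mul hK hk hs hsk (signedSingle_mem a x)
      (signedSingle_mem (a + k) y) (signedSingle_neg a x) (signedSingle_neg (a + k) y)).const_mul
      (mul_mem (inv_mem (natCast_mem K 4)) (hφK x y))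

variable {Γ : Subgroup SL(2, ℤ)} [Γ.FiniteIndex]

theorem eisensteinLSpan_le_valueSpan (hK : ContainsTrig K N) (hk : 3 ≤ k) (hk₀ : 0 < (k : ℤ))
    (hN : (N : ℝ) ∈ (Γ : Subgroup (GL (Fin 2) ℝ)).strictPeriods) :
    eisensteinLSpan K Γ N k hk₀ ≤ valueSpan K N k := by
  refine Submodule.span_le.mpr ?_
  rintro _ ⟨s, hs, hsk, f, hf, rfl⟩
  obtain ⟨φ, hφK, hφ, hL⟩ := exists_natCast_cpow_mul_L_eq_bilinearL hk hk₀ hN hf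
  obtain ⟨ℓ, hℓ, hmem⟩ := hasLimitInValueSpan_bilinearL hK hk hs hsk hφK hφ
  have hN₀ : (N : ℂ) ≠ 0 := NeZero.ne _
  have hcont : Continuous fun z : ℂ => (N : ℂ) ^ (-z) * ModularForm.L hk₀ f z :=
    (continuous_neg.const_cpow (.inl hN₀)).mul
      (differentiable_L_of_isZeroAt hk₀ hf.2.1 hf.2.2.1).continuous
  have hne : ∀ᶠ z : ℂ in 𝓝[≠] (s : ℂ), z ∉ ({1, (k : ℂ)} : Set ℂ) :=
    nhdsNE_le_cofinite _ (Set.toFinite _).compl_mem_cofinite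
  have hvalue : (N : ℂ) ^ (-(s : ℂ)) * ModularForm.L hk₀ f s = ℓ := by
    refine tendsto_nhds_unique ((hcont.tendsto (s : ℂ)).mono_left nhdsWithin_le_nhds)
      (hℓ.congr' ?_)
    filter_upwards [hne] with z hz
    rw [Set.mem_insert_iff, Set.mem_singleton_iff, not_or] at hz
    exact (hL z hz.1 hz.2).symm
  rw [cpow_neg, cpow_natCast] at hvalue
  have hLs : ModularForm.L hk₀ f s = N ^ s * ℓ := by
    rw [← hvalue, mul_inv_cancel_left₀ (pow_ne_zero s hN₀)]
  rw [SetLike.mem_coe, hLs, mul_left_comm]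
  exact mul_mem_submodule_of_mem (pow_mem (natCast_mem K N) s) hmem

end ValueSpan

section QuadraticCharacters

variable {K : IntermediateField ℚ ℂ}

lemma two_cos_two_sin_natCast_mul_mem {θ : ℂ} (hcos : 2 * cos θ ∈ K) (hsin : 2 * sin θ ∈ K)
    (n : ℕ) : 2 * cos (n * θ) ∈ K ∧ 2 * sin (n * θ) ∈ K := by
  have htwo : (2 : ℂ)⁻¹ ∈ K := inv_mem (natCast_mem K 2)
  induction n with
  | zero => simp
  | succ n ih =>
    have hsucc : ((n + 1 : ℕ) : ℂ) * θ = n * θ + θ := by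
      push_cast
      ring
    rw [hsucc, cos_add, sin_add]
    refine ⟨?_, ?_⟩
    · convert mul_mem htwo (sub_mem (mul_mem ih.1 hcos) (mul_mem ih.2 hsin)) using 1
      ring
    · convert mul_mem htwo (add_mem (mul_mem ih.2 hcos) (mul_mem ih.1 hsin)) using 1
      ring

lemma ContainsTrig.of_one {N : ℕ} [NeZero N] (hcos : 2 * cos (2 * π / N) ∈ K)
    (hsin : 2 * sin (2 * π / N) ∈ K) : ContainsTrig K N where
  cos_mem j := by
    rw [AddChar.map_neg_eq_inv, stdAddChar_eq_exp_val, ← Complex.exp_neg, ← neg_mul, ← two_cos]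
    exact (two_cos_two_sin_natCast_mul_mem hcos hsin j.val).1
  sin_mem j := by
    rw [AddChar.map_neg_eq_inv, stdAddChar_eq_exp_val, ← Complex.exp_neg, ← neg_mul]
    convert neg_mem (two_cos_two_sin_natCast_mul_mem hcos hsin j.val).2 using 1
    rw [two_sin]
    ring

lemma containsTrig_four (K : IntermediateField ℚ ℂ) : ContainsTrig K 4 := by
  have hangle : 2 * (π : ℂ) / (4 : ℕ) = π / 2 := by
    push_cast
    ring
  refine .of_one ?_ ?_ <;> rw [hangle]
  · rw [Complex.cos_pi_div_two, mul_zero]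
    exact zero_mem K
  · rw [Complex.sin_pi_div_two, mul_one]
    exact ofNat_mem K 2

lemma containsTrig_eight (hK : ((√2 : ℝ) : ℂ) ∈ K) : ContainsTrig K 8 := by
  have hangle : 2 * (π : ℂ) / (8 : ℕ) = ((π / 4 : ℝ) : ℂ) := by
    push_cast
    ring
  have hsqrt : (2 : ℂ) * ((√2 / 2 : ℝ) : ℂ) = (√2 : ℝ) := by
    push_cast
    ring
  refine .of_one ?_ ?_ <;> rw [hangle]
  · rwa [← ofReal_cos, Real.cos_pi_div_four, hsqrt]
  · rwa [← ofReal_sin, Real.sin_pi_div_four, hsqrt]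

lemma LSeriesHasSum_spreadCoeff {t : ℕ} (ht : t ≠ 0) {a : ℕ → ℂ} {s S : ℂ} (hs : s ≠ 0)
    (h : LSeriesHasSum a s S) : LSeriesHasSum (spreadCoeff t a) s (((t : ℂ) ^ s)⁻¹ * S) := by
  have hterm (f : ℕ → ℂ) : LSeries.term f s = fun n : ℕ => f n * ((n : ℂ) ^ s)⁻¹ := by
    funext n
    rw [LSeries.term_of_ne_zero' hs, div_eq_mul_inv]
  rw [LSeriesHasSum, hterm] at h ⊢
  rw [hasSum_spreadCoeff_mul_iff (u := fun n : ℕ => ((n : ℂ) ^ s)⁻¹) ht]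
  refine (h.mul_left ((t : ℂ) ^ s)⁻¹).congr_fun fun n => ?_
  rw [Nat.cast_mul, natCast_mul_natCast_cpow, mul_inv]
  ring

lemma LFunction_eq_of_LSeriesHasSum {N : ℕ} [NeZero N] {Φ : ZMod N → ℂ} {f : ℕ → ℂ} {s S : ℂ}
    (hs : 1 < s.re) (hf : ∀ n : ℕ, Φ n = f n) (h : LSeriesHasSum f s S) : LFunction Φ s = S := by
  rw [LFunction_eq_LSeries Φ hs, funext hf, h.LSeries_eq]

lemma LSeriesHasSum_LNegFour {s : ℂ} (hs : 1 < s.re) :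
    LSeriesHasSum (fun n : ℕ => ((χ₄ n : ℤ) : ℂ)) s (LNegFour s) :=
  (LSeriesSummable_of_one_lt_re (fun x : ZMod 4 => ((χ₄ x : ℤ) : ℂ)) hs).LSeriesHasSum

lemma LSeriesHasSum_LEight {s : ℂ} (hs : 1 < s.re) :
    LSeriesHasSum (fun n : ℕ => ((χ₈ n : ℤ) : ℂ)) s (LEight s) :=
  (LSeriesSummable_of_one_lt_re (fun x : ZMod 8 => ((χ₈ x : ℤ) : ℂ)) hs).LSeriesHasSum

lemma LSeriesHasSum_LNegEight {s : ℂ} (hs : 1 < s.re) :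
    LSeriesHasSum (fun n : ℕ => ((χ₈' n : ℤ) : ℂ)) s (LNegEight s) :=
  (LSeriesSummable_of_one_lt_re (fun x : ZMod 8 => ((χ₈' x : ℤ) : ℂ)) hs).LSeriesHasSum

lemma apply_zero_of_odd {A : Type*} [AddGroup A] {Φ : A → ℂ} {x : A} (hΦ : Φ.Odd)
    (hx : -x = x) : Φ x = 0 := by
  rw [← self_eq_neg, ← hΦ, hx]

lemma natCast_four_eq_of_even {Φ : ZMod 4 → ℂ} (hΦ : Φ.Even) (n : ℕ) :
    Φ n = Φ 1 * 1 + (Φ 2 - Φ 1) * spreadCoeff 2 1 n + (Φ 0 - Φ 2) * spreadCoeff 4 1 n := by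
  have h3 : Φ 3 = Φ 1 := hΦ 1
  have hdvd_two : 2 ∣ n ↔ n % 4 % 2 = 0 := by omega
  have hdvd_four : 4 ∣ n ↔ n % 4 = 0 := by omega
  have hlt : n % 4 < 4 := Nat.mod_lt _ (by norm_num)
  rw [← ZMod.natCast_mod n 4]
  simp only [spreadCoeff, Pi.one_apply, if_congr hdvd_two rfl rfl, if_congr hdvd_four rfl rfl]
  generalize n % 4 = r at hlt ⊢
  interval_cases r <;> simp [h3]

lemma LFunction_four_of_even {Φ : ZMod 4 → ℂ} (hΦ : Φ.Even) {s : ℂ} (hs : 1 < s.re) :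
    LFunction Φ s =
      (Φ 1 + (Φ 2 - Φ 1) * (2 ^ s)⁻¹ + (Φ 0 - Φ 2) * (4 ^ s)⁻¹) * riemannZeta s := by
  have hzeta := LSeriesHasSum_one hs
  have hspread (t : ℕ) (ht : t ≠ 0) := LSeriesHasSum_spreadCoeff ht (ne_zero_of_one_lt_re hs) hzeta
  have hsum := ((hzeta.smul (Φ 1)).add ((hspread 2 (by norm_num)).smul (Φ 2 - Φ 1))).add
    ((hspread 4 (by norm_num)).smul (Φ 0 - Φ 2))
  refine (LFunction_eq_of_LSeriesHasSum hs (natCast_four_eq_of_even hΦ) hsum).trans ?_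
  push_cast
  ring

lemma natCast_four_eq_of_odd {Φ : ZMod 4 → ℂ} (hΦ : Φ.Odd) (n : ℕ) :
    Φ n = Φ 1 * (χ₄ n : ℤ) := by
  have h0 : Φ 0 = 0 := apply_zero_of_odd hΦ (by decide)
  have h2 : Φ 2 = 0 := apply_zero_of_odd hΦ (by decide)
  have h3 : Φ 3 = -Φ 1 := hΦ 1
  have hlt : n % 4 < 4 := Nat.mod_lt _ (by norm_num)
  rw [← ZMod.natCast_mod n 4]
  generalize n % 4 = r at hlt ⊢
  rw [χ₄_nat_eq_if_mod_four]
  interval_cases r <;> simp [h0, h2, h3]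

lemma LFunction_four_of_odd {Φ : ZMod 4 → ℂ} (hΦ : Φ.Odd) {s : ℂ} (hs : 1 < s.re) :
    LFunction Φ s = Φ 1 * LNegFour s :=
  LFunction_eq_of_LSeriesHasSum hs (natCast_four_eq_of_odd hΦ)
    ((LSeriesHasSum_LNegFour hs).smul (Φ 1))

lemma natCast_eight_eq_of_even {Φ : ZMod 8 → ℂ} (hΦ : Φ.Even) (n : ℕ) :
    Φ n = (Φ 1 + Φ 3) / 2 * 1 + (Φ 2 - (Φ 1 + Φ 3) / 2) * spreadCoeff 2 1 n +
      (Φ 4 - Φ 2) * spreadCoeff 4 1 n + (Φ 0 - Φ 4) * spreadCoeff 8 1 n +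
      (Φ 1 - Φ 3) / 2 * (χ₈ n : ℤ) := by
  have h5 : Φ 5 = Φ 3 := hΦ 3
  have h6 : Φ 6 = Φ 2 := hΦ 2
  have h7 : Φ 7 = Φ 1 := hΦ 1
  have hdvd_two : 2 ∣ n ↔ n % 8 % 2 = 0 := by omega
  have hdvd_four : 4 ∣ n ↔ n % 8 % 4 = 0 := by omega
  have hdvd_eight : 8 ∣ n ↔ n % 8 = 0 := by omega
  have hlt : n % 8 < 8 := Nat.mod_lt _ (by norm_num)
  rw [← ZMod.natCast_mod n 8]
  simp only [spreadCoeff, Pi.one_apply, if_congr hdvd_two rfl rfl, if_congr hdvd_four rfl rfl,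
    if_congr hdvd_eight rfl rfl]
  generalize n % 8 = r at hlt ⊢
  rw [χ₈_nat_eq_if_mod_eight]
  interval_cases r <;> simp [h5, h6, h7] <;> ring

lemma LFunction_eight_of_even {Φ : ZMod 8 → ℂ} (hΦ : Φ.Even) {s : ℂ} (hs : 1 < s.re) :
    LFunction Φ s = ((Φ 1 + Φ 3) / 2 + (Φ 2 - (Φ 1 + Φ 3) / 2) * (2 ^ s)⁻¹ +
      (Φ 4 - Φ 2) * (4 ^ s)⁻¹ + (Φ 0 - Φ 4) * (8 ^ s)⁻¹) * riemannZeta s +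
      (Φ 1 - Φ 3) / 2 * LEight s := by
  have hzeta := LSeriesHasSum_one hs
  have hspread (t : ℕ) (ht : t ≠ 0) := LSeriesHasSum_spreadCoeff ht (ne_zero_of_one_lt_re hs) hzeta
  have hsum := ((((hzeta.smul ((Φ 1 + Φ 3) / 2)).add
    ((hspread 2 (by norm_num)).smul (Φ 2 - (Φ 1 + Φ 3) / 2))).add
    ((hspread 4 (by norm_num)).smul (Φ 4 - Φ 2))).add
    ((hspread 8 (by norm_num)).smul (Φ 0 - Φ 4))).add
    ((LSeriesHasSum_LEight hs).smul ((Φ 1 - Φ 3) / 2))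
  refine (LFunction_eq_of_LSeriesHasSum hs (natCast_eight_eq_of_even hΦ) hsum).trans ?_
  push_cast
  ring

lemma natCast_eight_eq_of_odd {Φ : ZMod 8 → ℂ} (hΦ : Φ.Odd) (n : ℕ) :
    Φ n = (Φ 1 - Φ 3) / 2 * (χ₄ n : ℤ) +
      Φ 2 * spreadCoeff 2 (fun m => ((χ₄ m : ℤ) : ℂ)) n +
      (Φ 1 + Φ 3) / 2 * (χ₈' n : ℤ) := by
  have h0 : Φ 0 = 0 := apply_zero_of_odd hΦ (by decide)
  have h4 : Φ 4 = 0 := apply_zero_of_odd hΦ (by decide)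
  have h5 : Φ 5 = -Φ 3 := hΦ 3
  have h6 : Φ 6 = -Φ 2 := hΦ 2
  have h7 : Φ 7 = -Φ 1 := hΦ 1
  have hdvd_two : 2 ∣ n ↔ n % 8 % 2 = 0 := by omega
  have hlt : n % 8 < 8 := Nat.mod_lt _ (by norm_num)
  simp only [spreadCoeff, if_congr hdvd_two rfl rfl, χ₈'_nat_eq_if_mod_eight,
    χ₄_nat_eq_if_mod_four]
  rw [← ZMod.natCast_mod n 8, show n % 2 = n % 8 % 2 by omega, show n % 4 = n % 8 % 4 by omega,
    show n / 2 % 2 = n % 8 / 2 % 2 by omega, show n / 2 % 4 = n % 8 / 2 by omega]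
  generalize n % 8 = r at hlt ⊢
  interval_cases r <;> simp [h0, h4, h5, h6, h7] <;> ring

lemma LFunction_eight_of_odd {Φ : ZMod 8 → ℂ} (hΦ : Φ.Odd) {s : ℂ} (hs : 1 < s.re) :
    LFunction Φ s = ((Φ 1 - Φ 3) / 2 + Φ 2 * (2 ^ s)⁻¹) * LNegFour s +
      (Φ 1 + Φ 3) / 2 * LNegEight s := by
  have hfour := LSeriesHasSum_LNegFour hs
  have hsum := ((hfour.smul ((Φ 1 - Φ 3) / 2)).add ((LSeriesHasSum_spreadCoeff two_ne_zero
    (ne_zero_of_one_lt_re hs) hfour).smul (Φ 2))).add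
    ((LSeriesHasSum_LNegEight hs).smul ((Φ 1 + Φ 3) / 2))
  refine (LFunction_eq_of_LSeriesHasSum hs (natCast_eight_eq_of_odd hΦ) hsum).trans ?_
  push_cast
  ring

variable {k : ℕ}

lemma valueSpan_le {N : ℕ} [NeZero N] {M : Submodule K ℂ} (hpi : (π : ℂ) ^ (k - 1) ∈ M)
    (hM : ∀ Φ : ZMod N → ℂ, (∀ x, Φ x ∈ K) → (∀ x, Φ (-x) = (-1) ^ k * Φ x) →
      LFunction Φ (k - 1 : ℕ) ∈ M) : valueSpan K N k ≤ M := by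
  refine Submodule.span_le.mpr ?_
  rintro _ (rfl | ⟨Φ, hΦ, hpar, rfl⟩)
  exacts [hpi, hM Φ hΦ hpar]

lemma one_lt_re_natCast_pred (hk : 3 ≤ k) : 1 < ((k - 1 : ℕ) : ℂ).re := by
  rw [natCast_re]
  exact_mod_cast (by omega : 1 < k - 1)

lemma inv_ofNat_cpow_natCast_mem (K : IntermediateField ℚ ℂ) (t n : ℕ) [t.AtLeastTwo] :
    ((ofNat(t) : ℂ) ^ (n : ℂ))⁻¹ ∈ K := by
  rw [cpow_natCast]
  exact inv_mem (pow_mem (ofNat_mem K t) n)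

lemma valueSpan_four_le_of_even (hk : 3 ≤ k) (heven : Even k) :
    valueSpan K 4 k ≤ Submodule.span K {(π : ℂ) ^ (k - 1), riemannZeta ((k - 1 : ℕ) : ℂ)} := by
  refine valueSpan_le (Submodule.mem_span_of_mem (by simp)) fun Φ hΦ hpar => ?_
  rw [LFunction_four_of_even (fun x => by rw [hpar, heven.neg_one_pow, one_mul])
    (one_lt_re_natCast_pred hk)]
  refine mul_mem_submodule_of_mem ?_ (Submodule.mem_span_of_mem (by simp))
  exact add_mem (add_mem (hΦ 1) (mul_mem (sub_mem (hΦ 2) (hΦ 1))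
    (inv_ofNat_cpow_natCast_mem K 2 _))) (mul_mem (sub_mem (hΦ 0) (hΦ 2))
    (inv_ofNat_cpow_natCast_mem K 4 _))

lemma valueSpan_four_le_of_odd (hk : 3 ≤ k) (hodd : Odd k) :
    valueSpan K 4 k ≤ Submodule.span K {(π : ℂ) ^ (k - 1), LNegFour ((k - 1 : ℕ) : ℂ)} := by
  refine valueSpan_le (Submodule.mem_span_of_mem (by simp)) fun Φ hΦ hpar => ?_
  rw [LFunction_four_of_odd (fun x => by rw [hpar, hodd.neg_one_pow, neg_one_mul])
    (one_lt_re_natCast_pred hk)]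
  exact mul_mem_submodule_of_mem (hΦ 1) (Submodule.mem_span_of_mem (by simp))

lemma valueSpan_eight_le_of_even (hk : 3 ≤ k) (heven : Even k) :
    valueSpan K 8 k ≤ Submodule.span K
      {(π : ℂ) ^ (k - 1), riemannZeta ((k - 1 : ℕ) : ℂ), LEight ((k - 1 : ℕ) : ℂ)} := by
  refine valueSpan_le (Submodule.mem_span_of_mem (by simp)) fun Φ hΦ hpar => ?_
  rw [LFunction_eight_of_even (fun x => by rw [hpar, heven.neg_one_pow, one_mul])
    (one_lt_re_natCast_pred hk)]
  have hhalf := div_mem (add_mem (hΦ 1) (hΦ 3)) (ofNat_mem K 2)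
  refine add_mem (mul_mem_submodule_of_mem ?_ (Submodule.mem_span_of_mem (by simp)))
    (mul_mem_submodule_of_mem (div_mem (sub_mem (hΦ 1) (hΦ 3)) (ofNat_mem K 2))
      (Submodule.mem_span_of_mem (by simp)))
  exact add_mem (add_mem (add_mem hhalf (mul_mem (sub_mem (hΦ 2) hhalf)
    (inv_ofNat_cpow_natCast_mem K 2 _))) (mul_mem (sub_mem (hΦ 4) (hΦ 2))
    (inv_ofNat_cpow_natCast_mem K 4 _))) (mul_mem (sub_mem (hΦ 0) (hΦ 4))
    (inv_ofNat_cpow_natCast_mem K 8 _))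

lemma valueSpan_eight_le_of_odd (hk : 3 ≤ k) (hodd : Odd k) :
    valueSpan K 8 k ≤ Submodule.span K
      {(π : ℂ) ^ (k - 1), LNegFour ((k - 1 : ℕ) : ℂ), LNegEight ((k - 1 : ℕ) : ℂ)} := by
  refine valueSpan_le (Submodule.mem_span_of_mem (by simp)) fun Φ hΦ hpar => ?_
  rw [LFunction_eight_of_odd (fun x => by rw [hpar, hodd.neg_one_pow, neg_one_mul])
    (one_lt_re_natCast_pred hk)]
  refine add_mem (mul_mem_submodule_of_mem ?_ (Submodule.mem_span_of_mem (by simp)))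
    (mul_mem_submodule_of_mem (div_mem (add_mem (hΦ 1) (hΦ 3)) (ofNat_mem K 2))
      (Submodule.mem_span_of_mem (by simp)))
  exact add_mem (div_mem (sub_mem (hΦ 1) (hΦ 3)) (ofNat_mem K 2))
    (mul_mem (hΦ 2) (inv_ofNat_cpow_natCast_mem K 2 _))

end QuadraticCharacters

section CuspValues

open scoped Matrix ModularForm

/-- The points `(n + 1) i`, along which a form tends to its value at the cusp `∞`. -/
def imaginarySeq (n : ℕ) : ℍ := ⟨(n + 1) * I, by simpa using n.cast_add_one_pos (α := ℝ)⟩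

lemma im_imaginarySeq (n : ℕ) : (imaginarySeq n).im = n + 1 := by
  simp [imaginarySeq, UpperHalfPlane.im]

lemma tendsto_imaginarySeq : Tendsto imaginarySeq atTop atImInfty := by
  rw [atImInfty, tendsto_comap_iff]
  refine (tendsto_atTop_add_const_right _ 1 tendsto_natCast_atTop_atTop).congr fun n => ?_
  exact (im_imaginarySeq n).symm

lemma imaginarySeq_mem_verticalStrip (n : ℕ) : imaginarySeq n ∈ verticalStrip 1 1 := by
  rw [mem_verticalStrip_iff, im_imaginarySeq]
  exact ⟨by simp [imaginarySeq, UpperHalfPlane.re], by linarith [n.cast_nonneg (α := ℝ)]⟩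

lemma tendsto_eisSummand_imaginarySeq {k : ℕ} (hk : k ≠ 0) (v : Fin 2 → ℤ) :
    Tendsto (fun n => eisSummand k v (imaginarySeq n)) atTop
      (𝓝 (if v 0 = 0 then ((v 1 : ℂ) ^ k)⁻¹ else 0)) := by
  split_ifs with hv
  · simp [eisSummand, hv]
  · have hnorm : Tendsto (fun n => ‖(v 0 : ℂ) * (imaginarySeq n : ℂ) + v 1‖) atTop atTop := by
      refine tendsto_atTop_mono (fun n => ?_)
        (tendsto_atTop_add_const_right _ 1 (tendsto_natCast_atTop_atTop (R := ℝ)))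
      have him : ((v 0 : ℂ) * (imaginarySeq n : ℂ) + v 1).im = v 0 * (n + 1) := by
        simp [imaginarySeq]
      have habs : (1 : ℝ) ≤ |(v 0 : ℝ)| := mod_cast Int.one_le_abs hv
      calc (n + 1 : ℝ) ≤ |(v 0 : ℝ)| * (n + 1) := le_mul_of_one_le_left (by positivity) habs
        _ = |((v 0 : ℂ) * (imaginarySeq n : ℂ) + v 1).im| := by
          rw [him, abs_mul, abs_of_nonneg (by positivity : (0 : ℝ) ≤ n + 1)]
        _ ≤ _ := abs_im_le_norm _
    rw [tendsto_zero_iff_norm_tendsto_zero]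
    simp only [eisSummand, zpow_neg, zpow_natCast, norm_inv, norm_pow]
    exact tendsto_inv_atTop_zero.comp ((tendsto_pow_atTop hk).comp hnorm)

variable {N k : ℕ}

lemma tsum_indicator_gammaSet_ite (a : Fin 2 → ZMod N) :
    ∑' v, (gammaSet N 1 a).indicator
      (fun v : Fin 2 → ℤ => if v 0 = 0 then ((v 1 : ℂ) ^ k)⁻¹ else 0) v =
    (if a = ![0, 1] then 1 else 0) + (-1) ^ k * (if a = -![0, 1] then 1 else 0) := by
  have hne : (![0, 1] : Fin 2 → ℤ) ≠ -![0, 1] := by decide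
  rw [tsum_eq_sum (s := {![0, 1], -![0, 1]}), Finset.sum_pair hne]
  · have hcast : ((↑) ∘ (![0, 1] : Fin 2 → ℤ) : Fin 2 → ZMod N) = ![0, 1] := by
      ext i
      fin_cases i <;> simp
    have hcast_neg : ((↑) ∘ (-![0, 1] : Fin 2 → ℤ) : Fin 2 → ZMod N) = -![0, 1] := by
      ext i
      fin_cases i <;> simp
    have hsign : ((-1 : ℂ) ^ k)⁻¹ = (-1) ^ k := by rw [← inv_pow, inv_neg, inv_one]
    simp only [Set.indicator_apply, gammaSet, Set.mem_ofPred_eq, hcast, hcast_neg, eq_comm (a := a)]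
    simp [hsign]
  · intro v hv
    refine Set.indicator_apply_eq_zero.mpr fun hmem => if_neg fun h0 => hv ?_
    have hgcd := hmem.2
    rw [h0, Int.gcd_zero_left] at hgcd
    rw [Finset.mem_insert, Finset.mem_singleton]
    refine (Int.natAbs_eq_natAbs_iff.mp hgcd : v 1 = 1 ∨ v 1 = -1).imp (fun h1 => ?_) fun h1 => ?_
    all_goals ext i; fin_cases i <;> simp [h0, h1]

lemma tendsto_eisensteinSeries_imaginarySeq (hk : 3 ≤ k) (a : Fin 2 → ZMod N) :
    Tendsto (fun n => eisensteinSeries a k (imaginarySeq n)) atTop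
      (𝓝 ((if a = ![0, 1] then 1 else 0) + (-1) ^ k * (if a = -![0, 1] then 1 else 0))) := by
  have hk₂ : (2 : ℝ) < (k : ℤ) := by norm_cast
  have htsum (z : ℍ) : eisensteinSeries a k z =
      ∑' v, (gammaSet N 1 a).indicator (fun v => eisSummand k v z) v :=
    tsum_subtype (gammaSet N 1 a) fun v => eisSummand k v z
  simp only [htsum, ← tsum_indicator_gammaSet_ite]
  refine tendsto_tsum_of_dominated_convergence
    ((summable_one_div_norm_rpow hk₂).mul_left (r ⟨⟨1, 1⟩, one_pos⟩ ^ (-((k : ℤ) : ℝ))))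
    (fun v => ?_) (.of_forall fun n v => ?_)
  · by_cases hv : v ∈ gammaSet N 1 a
    · simpa only [Set.indicator_of_mem hv] using tendsto_eisSummand_imaginarySeq (by omega) v
    · simpa only [Set.indicator_of_notMem hv] using tendsto_const_nhds
  · refine (norm_indicator_le_norm_self _ _).trans ?_
    simp only [eisSummand, norm_zpow]
    exact_mod_cast summand_bound_of_mem_verticalStrip (k := (k : ℤ)) (by positivity) v one_pos
      (imaginarySeq_mem_verticalStrip n)

lemma eisensteinSeries_neg (a : Fin 2 → ZMod N) (z : ℍ) :
    eisensteinSeries (-a) k z = (-1) ^ k * eisensteinSeries a k z := by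
  have hrow : a ᵥ* (-1 : SL(2, ℤ)) = -a := by
    ext i
    fin_cases i <;> simp [Matrix.vecMul, dotProduct]
  have hsign : ((-1 : ℂ) ^ k)⁻¹ = (-1) ^ k := by rw [← inv_pow, inv_neg, inv_one]
  have hslash := congr_fun (eisensteinSeries_slash_apply a k (-1)) z
  rw [hrow, ModularForm.SL_slash_apply] at hslash
  simpa [UpperHalfPlane.denom, hsign, mul_comm] using hslash.symm

lemma eisensteinSeries_eq_zero_of_gammaSet_eq_empty {a : Fin 2 → ZMod N} {k : ℤ}
    (ha : gammaSet N 1 a = ∅) (z : ℍ) : eisensteinSeries a k z = 0 := by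
  have : IsEmpty (gammaSet N 1 a) := Set.isEmpty_coe_sort.mpr ha
  rw [eisensteinSeries, tsum_empty]

/-- The residues modulo `N` of the bottom row of a matrix. -/
def bottomRow (N : ℕ) (γ : SL(2, ℤ)) : Fin 2 → ZMod N := ![(γ 1 0 : ℤ), (γ 1 1 : ℤ)]

/-- For `f = ∑ a, c a • eisensteinSeries a k`, the value of `f ∣[k] γ⁻¹` at `∞` is
`cuspValue k c b`, where `b` is the bottom row of `γ` modulo `N`. -/
def cuspValue (k : ℕ) (c : (Fin 2 → ZMod N) → ℂ) (b : Fin 2 → ZMod N) : ℂ :=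
  c b + (-1) ^ k * c (-b)

lemma cuspValue_neg (c : (Fin 2 → ZMod N) → ℂ) (b : Fin 2 → ZMod N) :
    cuspValue k c (-b) = (-1) ^ k * cuspValue k c b := by
  have hsign : (-1 : ℂ) ^ k * (-1) ^ k = 1 := by rw [← mul_pow, neg_one_mul, neg_neg, one_pow]
  rw [cuspValue, cuspValue, neg_neg]
  linear_combination -c (-b) * hsign

lemma vecMul_inv_eq_iff (γ : SL(2, ℤ)) (a b : Fin 2 → ZMod N) :
    a ᵥ* (γ⁻¹ : SL(2, ℤ)) = b ↔ a = b ᵥ* γ := by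
  have hcancel (γ : SL(2, ℤ)) (a : Fin 2 → ZMod N) :
      (a ᵥ* γ : Fin 2 → ZMod N) ᵥ* (γ⁻¹ : SL(2, ℤ)) = a := by
    rw [Matrix.vecMul_vecMul, ← Matrix.SpecialLinearGroup.coe_mul, ← map_mul, mul_inv_cancel,
      map_one, Matrix.SpecialLinearGroup.coe_one, Matrix.vecMul_one]
  constructor
  · rintro rfl
    simpa using (hcancel γ⁻¹ a).symm
  · rintro rfl
    exact hcancel γ b

lemma vecMul_eq_bottomRow (γ : SL(2, ℤ)) : ![0, 1] ᵥ* γ = bottomRow N γ := by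
  ext i
  fin_cases i <;> simp [bottomRow, Matrix.vecMul, dotProduct]

lemma tendsto_slash_inv_imaginarySeq [NeZero N] (hk : 3 ≤ k) {f : ℍ → ℂ}
    {c : (Fin 2 → ZMod N) → ℂ} (hf : f = ∑ a, c a • eisensteinSeries a k) (γ : SL(2, ℤ)) :
    Tendsto (fun n => (f ∣[(k : ℤ)] γ⁻¹) (imaginarySeq n)) atTop
      (𝓝 (cuspValue k c (bottomRow N γ))) := by
  have hslash : f ∣[(k : ℤ)] γ⁻¹ =
      ∑ a, c a • eisensteinSeries (a ᵥ* (γ⁻¹ : SL(2, ℤ))) k := by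
    simp_rw [hf, SlashAction.sum_slash, ModularForm.SL_smul_slash, eisensteinSeries_slash_apply]
  have hlim := tendsto_finsetSum Finset.univ fun a _ =>
    (tendsto_eisensteinSeries_imaginarySeq hk (a ᵥ* (γ⁻¹ : SL(2, ℤ)))).const_mul (c a)
  simp only [hslash, Finset.sum_apply, Pi.smul_apply, smul_eq_mul]
  convert hlim using 2
  simp only [vecMul_inv_eq_iff, Matrix.neg_vecMul, vecMul_eq_bottomRow, mul_add,
    Finset.sum_add_distrib, mul_ite, mul_one, mul_zero, Finset.sum_ite_eq', Finset.mem_univ,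
    if_true, cuspValue]
  ring

lemma cuspValue_eq_zero_of_isZeroAtImInfty [NeZero N] (hk : 3 ≤ k) {f : ℍ → ℂ}
    {c : (Fin 2 → ZMod N) → ℂ} (hf : f = ∑ a, c a • eisensteinSeries a k) {γ : SL(2, ℤ)}
    (hγ : IsZeroAtImInfty (f ∣[(k : ℤ)] γ⁻¹)) : cuspValue k c (bottomRow N γ) = 0 :=
  tendsto_nhds_unique (tendsto_slash_inv_imaginarySeq hk hf γ) (hγ.comp tendsto_imaginarySeq)

lemma cuspValue_bottomRow_mul_eq_of_slash_eq [NeZero N] (hk : 3 ≤ k) {f : ℍ → ℂ}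
    {c : (Fin 2 → ZMod N) → ℂ} (hf : f = ∑ a, c a • eisensteinSeries a k) {g : SL(2, ℤ)}
    (hg : f ∣[(k : ℤ)] g = f) (γ : SL(2, ℤ)) :
    cuspValue k c (bottomRow N (γ * g)) = cuspValue k c (bottomRow N γ) := by
  have hslash : f ∣[(k : ℤ)] (γ * g)⁻¹ = f ∣[(k : ℤ)] γ⁻¹ := by
    nth_rw 1 [← hg]
    rw [← SlashAction.slash_mul, mul_inv_rev, mul_inv_cancel_left]
  exact tendsto_nhds_unique (hslash ▸ tendsto_slash_inv_imaginarySeq hk hf (γ * g))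
    (tendsto_slash_inv_imaginarySeq hk hf γ)

lemma exists_bottomRow_eq {x y : ℤ} (hxy : IsCoprime x y) :
    ∃ γ : SL(2, ℤ), γ 1 0 = x ∧ γ 1 1 = y := by
  obtain ⟨γ, -, hγ⟩ := ModularGroup.bottom_row_surj (R := ℤ) (a := ![x, y]) hxy
  exact ⟨γ, congr_fun hγ 0, congr_fun hγ 1⟩

lemma eq_zero_of_cuspValue_bottomRow_eq_zero [NeZero N] {f : ℍ → ℂ} {c : (Fin 2 → ZMod N) → ℂ}
    (hf : f = ∑ a, c a • eisensteinSeries a k)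
    (hc : ∀ γ : SL(2, ℤ), cuspValue k c (bottomRow N γ) = 0) : f = 0 := by
  have hterm (a : Fin 2 → ZMod N) (z : ℍ) : cuspValue k c a * eisensteinSeries a k z = 0 := by
    obtain ha | ⟨v, hva, hv⟩ := (gammaSet N 1 a).eq_empty_or_nonempty
    · rw [eisensteinSeries_eq_zero_of_gammaSet_eq_empty ha, mul_zero]
    · obtain ⟨γ, h0, h1⟩ := exists_bottomRow_eq (Int.isCoprime_iff_gcd_eq_one.mpr hv)
      have hrow : bottomRow N γ = a := by
        rw [← hva, bottomRow, h0, h1]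
        ext i
        fin_cases i <;> rfl
      rw [← hrow, hc, zero_mul]
  ext z
  have hz : f z = ∑ a, c a * eisensteinSeries a k z := by simp [hf]
  have hz_neg : f z = ∑ a, (-1) ^ k * c (-a) * eisensteinSeries a k z := by
    rw [hz, ← Equiv.sum_comp (Equiv.neg (Fin 2 → ZMod N))]
    refine Finset.sum_congr rfl fun a _ => ?_
    rw [Equiv.neg_apply, eisensteinSeries_neg]
    ring
  have htwo : f z + f z = 0 := by
    nth_rw 1 [hz]
    rw [hz_neg, ← Finset.sum_add_distrib]
    exact Finset.sum_eq_zero fun a _ => by rw [← hterm a z, cuspValue]; ring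
  exact self_eq_neg.mp (eq_neg_of_add_eq_zero_left htwo)

end CuspValues

section LevelFourOdd

open scoped ModularForm

lemma apply_add_natCast_mul_eq {N : ℕ} {h : ZMod N → ZMod N → ℂ}
    (hT : ∀ x y : ℤ, IsCoprime x y → h x (x + y) = h x y) {x y : ℤ} (hxy : IsCoprime x y)
    (n : ℕ) : h x (n * x + y) = h x y := by
  induction n with
  | zero => simp
  | succ n ih =>
    rw [← ih]
    have hcop : IsCoprime x (n * x + y) := mul_comm x (n : ℤ) ▸ hxy.mul_add_left_right n
    have hstep := hT x (n * x + y) hcop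
    push_cast at hstep ⊢
    rw [← hstep]
    congr 1
    ring

/-- The stabilizer of `∞` has three orbits on the primitive vectors modulo `4` up to sign, those of
`(0, 1)`, `(1, 0)` and `(2, 1)`. -/
lemma eq_zero_of_apply_add_eq {h : ZMod 4 → ZMod 4 → ℂ}
    (hT : ∀ x y : ℤ, IsCoprime x y → h x (x + y) = h x y)
    (hneg : ∀ x y, h (-x) (-y) = -h x y) (h01 : h 0 1 = 0) (h10 : h 1 0 = 0) {x y : ℤ}
    (hxy : IsCoprime x y) : h x y = 0 := by
  have h1 {x y : ℤ} (hxy : IsCoprime x y) (hx : (x : ZMod 4) = 1) : h x y = 0 := by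
    rw [← apply_add_natCast_mul_eq hT hxy (-(y : ZMod 4)).val]
    simp [hx, h10]
  obtain ⟨a, b, hab⟩ := hxy.map (Int.castRingHom (ZMod 4))
  have hcases : ∀ a b x y : ZMod 4, a * x + b * y = 1 →
      x = 0 ∧ y = 1 ∨ -x = 0 ∧ -y = 1 ∨ x = 1 ∨ -x = 1 ∨ -x = x ∧ -y = x + y := by decide
  rcases hcases a b x y hab with ⟨hx, hy⟩ | ⟨hx, hy⟩ | hx | hx | ⟨hx, hy⟩
  · rw [hx, hy, h01]
  · rw [← neg_eq_zero, ← hneg, hx, hy, h01]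
  · exact h1 hxy hx
  · rw [← neg_eq_zero, ← hneg]
    exact mod_cast h1 hxy.neg_neg (by exact_mod_cast hx)
  · exact self_eq_neg.mp (by rw [← hneg, hx, hy, hT x y hxy])

variable {Γ : Subgroup SL(2, ℤ)} {k : ℕ} {K : IntermediateField ℚ ℂ}

lemma slash_T_eq {k : ℤ} (hΓ : (1 : ℝ) ∈ (Γ : Subgroup (GL (Fin 2) ℝ)).strictPeriods)
    (f : ModularForm (Γ : Subgroup (GL (Fin 2) ℝ)) k) : ⇑f ∣[k] ModularGroup.T = ⇑f := by
  have hT : Matrix.SpecialLinearGroup.mapGL ℝ ModularGroup.T =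
      Matrix.GeneralLinearGroup.upperRightHom 1 := by
    ext i j
    fin_cases i <;> fin_cases j <;> simp [ModularGroup.coe_T]
  refine SlashInvariantFormClass.slash_action_eq f _ ?_
  exact hT ▸ Subgroup.mem_strictPeriods_iff.mp hΓ

theorem eq_zero_of_mem_eisensteinZeroInfty_four_of_odd (hk : 3 ≤ k) (hodd : Odd k)
    (hΓ : (1 : ℝ) ∈ (Γ : Subgroup (GL (Fin 2) ℝ)).strictPeriods)
    {f : ModularForm (Γ : Subgroup (GL (Fin 2) ℝ)) k} (hf : f ∈ eisensteinZeroInfty K Γ 4 k) :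
    f = 0 := by
  obtain ⟨hE, h0, hinf, -⟩ := hf
  obtain ⟨c, hc⟩ := (Submodule.mem_span_range_iff_exists_fun ℂ).mp hE
  have hT (x y : ℤ) (hxy : IsCoprime x y) :
      cuspValue k c ![x, x + y] = cuspValue k c ![x, y] := by
    obtain ⟨γ, rfl, rfl⟩ := exists_bottomRow_eq hxy
    have hrow : bottomRow 4 (γ * ModularGroup.T) =
        ![((γ 1 0 : ℤ) : ZMod 4), (γ 1 0 : ℤ) + (γ 1 1 : ℤ)] := by
      simp [bottomRow, ModularGroup.coe_T, Matrix.mul_apply, Fin.sum_univ_two]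
    rw [← hrow]
    exact cuspValue_bottomRow_mul_eq_of_slash_eq hk hc.symm (slash_T_eq hΓ f) γ
  have hneg (x y : ZMod 4) : cuspValue k c ![-x, -y] = -cuspValue k c ![x, y] := by
    simpa [hodd.neg_one_pow] using cuspValue_neg (k := k) c ![x, y]
  have h01 : cuspValue k c ![0, 1] = 0 := by
    have := cuspValue_eq_zero_of_isZeroAtImInfty hk hc.symm (γ := 1) (by
      simpa using OnePoint.isZeroAt_infty_iff.mp hinf)
    simpa [bottomRow] using this
  have h10 : cuspValue k c ![1, 0] = 0 := by
    have hzero : IsZeroAtImInfty (⇑f ∣[(k : ℤ)] ModularGroup.S) := h0 ModularGroup.S (by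
      rw [OnePoint.smul_infty_eq_ite]
      simp [ModularGroup.coe_S])
    have := cuspValue_eq_zero_of_isZeroAtImInfty hk hc.symm (γ := ModularGroup.S⁻¹) (by
      rwa [inv_inv])
    rw [← neg_eq_zero, ← hneg]
    simpa [bottomRow, ModularGroup.coe_S, Matrix.adjugate_fin_two] using this
  refine DFunLike.coe_injective (eq_zero_of_cuspValue_bottomRow_eq_zero hc.symm fun γ => ?_)
  exact eq_zero_of_apply_add_eq (h := fun x y => cuspValue k c ![x, y]) hT hneg h01 h10
    (γ.isCoprime_row 1)

theorem eisensteinLSpan_four_eq_bot_of_odd [Γ.FiniteIndex] (hk : 3 ≤ k) (hodd : Odd k)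
    (hk₀ : 0 < (k : ℤ)) (hΓ : (1 : ℝ) ∈ (Γ : Subgroup (GL (Fin 2) ℝ)).strictPeriods) :
    eisensteinLSpan K Γ 4 k hk₀ = ⊥ := by
  refine Submodule.span_eq_bot.mpr ?_
  rintro _ ⟨s, -, -, f, hf, rfl⟩
  obtain rfl := eq_zero_of_mem_eisensteinZeroInfty_four_of_odd hk hodd hΓ hf
  have hΛ : ModularForm.Λ hk₀ (0 : ModularForm (Γ : Subgroup (GL (Fin 2) ℝ)) k) s = 0 :=
    (congr_fun (isStrongFEPair_weakFEPair_of_isZeroAt hk₀ hf.2.1 hf.2.2.1).Λ_eq s).trans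
      (by simp [mellin, ModularForm.weakFEPair])
  rw [ModularForm.L, hΛ, zero_mul, mul_zero]

end LevelFourOdd

lemma natCast_mem_strictPeriods_Gamma1 (N n : ℕ) :
    (n : ℝ) ∈ (CongruenceSubgroup.Gamma1 N : Subgroup (GL (Fin 2) ℝ)).strictPeriods := by
  rw [CongruenceSubgroup.strictPeriods_Gamma1]
  exact AddSubgroup.mem_zmultiples_iff.mpr ⟨n, by simp⟩

theorem mainTheorem4_general {k : ℕ} (hk : 3 ≤ k) (hk₀ : 0 < (k : ℤ)) (K : IntermediateField ℚ ℂ)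
    (Γ : Subgroup SL(2, ℤ)) [Γ.FiniteIndex] :
    ((4 : ℝ) ∈ (Γ : Subgroup (GL (Fin 2) ℝ)).strictPeriods →
      (Even k → eisensteinLSpan K Γ 4 k hk₀ ≤
        Submodule.span K {(π : ℂ) ^ (k - 1), riemannZeta ((k - 1 : ℕ) : ℂ)}) ∧
      (Odd k → eisensteinLSpan K Γ 4 k hk₀ ≤
        Submodule.span K {(π : ℂ) ^ (k - 1), LNegFour ((k - 1 : ℕ) : ℂ)})) ∧
    ((1 : ℝ) ∈ (Γ : Subgroup (GL (Fin 2) ℝ)).strictPeriods →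
      Odd k → eisensteinLSpan K Γ 4 k hk₀ = ⊥) ∧
    (((√2 : ℝ) : ℂ) ∈ K → (8 : ℝ) ∈ (Γ : Subgroup (GL (Fin 2) ℝ)).strictPeriods →
      (Even k → eisensteinLSpan K Γ 8 k hk₀ ≤ Submodule.span K
        {(π : ℂ) ^ (k - 1), riemannZeta ((k - 1 : ℕ) : ℂ), LEight ((k - 1 : ℕ) : ℂ)}) ∧
      (Odd k → eisensteinLSpan K Γ 8 k hk₀ ≤ Submodule.span K
        {(π : ℂ) ^ (k - 1), LNegFour ((k - 1 : ℕ) : ℂ), LNegEight ((k - 1 : ℕ) : ℂ)})) := by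
  refine ⟨fun hΓ => ?_, fun hΓ hodd => eisensteinLSpan_four_eq_bot_of_odd hk hodd hk₀ hΓ,
    fun hK hΓ => ?_⟩
  · have hle := eisensteinLSpan_le_valueSpan (containsTrig_four K) hk hk₀ hΓ
    exact ⟨fun heven => hle.trans (valueSpan_four_le_of_even hk heven),
      fun hodd => hle.trans (valueSpan_four_le_of_odd hk hodd)⟩
  · have hle := eisensteinLSpan_le_valueSpan (containsTrig_eight hK) hk hk₀ hΓ
    exact ⟨fun heven => hle.trans (valueSpan_eight_le_of_even hk heven),
      fun hodd => hle.trans (valueSpan_eight_le_of_odd hk hodd)⟩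

end

theorem mainTheorem4 (k : ℕ) (hk : 3 ≤ k) :
    (Even k →
      eisensteinLSpan QField (CongruenceSubgroup.Gamma1 4) 4 k (by omega) ≤
        Submodule.span QField {(π : ℂ) ^ (k - 1), riemannZeta ((k - 1 : ℕ) : ℂ)}) ∧
    (Odd k →
      eisensteinLSpan QField (CongruenceSubgroup.Gamma1 4) 4 k (by omega) ≤
        Submodule.span QField (∅ : Set ℂ)) ∧
    (Even k →
      eisensteinLSpan QField (CongruenceSubgroup.Gamma 4) 4 k (by omega) ≤
        Submodule.span QField {(π : ℂ) ^ (k - 1), riemannZeta ((k - 1 : ℕ) : ℂ)}) ∧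
    (Odd k →
      eisensteinLSpan QField (CongruenceSubgroup.Gamma 4) 4 k (by omega) ≤
        Submodule.span QField {(π : ℂ) ^ (k - 1), LNegFour ((k - 1 : ℕ) : ℂ)}) ∧
    (Even k →
      eisensteinLSpan QSqrtTwo (CongruenceSubgroup.Gamma1 8) 8 k (by omega) ≤
        Submodule.span QSqrtTwo
          {(π : ℂ) ^ (k - 1), riemannZeta ((k - 1 : ℕ) : ℂ), LEight ((k - 1 : ℕ) : ℂ)}) ∧
    (Odd k →
      eisensteinLSpan QSqrtTwo (CongruenceSubgroup.Gamma1 8) 8 k (by omega) ≤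
        Submodule.span QSqrtTwo
          {(π : ℂ) ^ (k - 1), LNegFour ((k - 1 : ℕ) : ℂ), LNegEight ((k - 1 : ℕ) : ℂ)}) := by
  have hk₀ : 0 < (k : ℤ) := by omega
  have hΓ₁ := mainTheorem4_general hk hk₀ QField (CongruenceSubgroup.Gamma1 4)
  have hΓ := (mainTheorem4_general hk hk₀ QField (CongruenceSubgroup.Gamma 4)).1 (by simp)
  have hΓ₈ := (mainTheorem4_general hk hk₀ QSqrtTwo (CongruenceSubgroup.Gamma1 8)).2.2
    (IntermediateField.mem_adjoin_simple_self ℚ _) (natCast_mem_strictPeriods_Gamma1 8 8)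
  exact ⟨(hΓ₁.1 (natCast_mem_strictPeriods_Gamma1 4 4)).1,
    fun hodd => (hΓ₁.2.1 (by simp) hodd).trans_le bot_le, hΓ.1, hΓ.2, hΓ₈.1, hΓ₈.2⟩
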